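/- **Setting.** Let $m\ge 2$ agents be the vertices of a connected undirected graph $\mathcal G$, and let $W\in\mathbb R^{m\times m}$ be symmetric positive semidefinite with $W_{ij}=0$ whenever $i\ne j$ are not adjacent and $\ker W=\operatorname{span}\{\mathbf 1\}$. Let $B\in\mathbb R^{p\times d}$ with $\ker B\ne\{0\}$, and let $f_1,\dots,f_m:\mathbb R^d\to\mathbb R$ be differentiable, $\mu$-strongly convex ($\mu>0$) and $L$-smooth, i.e. $f_i(x)+\langle\nabla f_i(x),y-x\rangle+\frac{\mu}{2}\|y-x\|^2\le f_i(y)\le f_i(x)+\langle\nabla f_i(x),y-x\rangle+\frac{L}{2}\|y-x\|^2$. Consider $$\min F(\mathbf x)=\sum_{i=1}^m f_i(x_i)\quad\text{s.t. } \mathbf W\mathbf x=0,\ \mathbf B\mathbf x=0,\qquad \mathbf W=W\otimes I,\ \mathbf B=I\otimes B .$$ Let $E\in\mathbb R^{d\times d_t}$ have columns that form an orthonormal basis of $\ker B$, and put $h_i(t)=f_i(Et)$, $H(\mathbf t)=\sum_i h_i(t_i)$, $H^*(\mathbf z)=\sup_{\mathbf t}\{\langle \mathbf z,\mathbf t\rangle-H(\mathbf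 t)\}$. For positive semidefinite $M\neq0$ let $\chi(M)=\lambda_{\max}(M)/\lambda_{\min}^+(M)$, where $\lambda^+_{\min}$ is the least nonzero eigenvalue. For a polynomial $P$ and $M=P(W)$, the dual objective is $\Psi_M(\mathbf z)=H^*((M\otimes I)\mathbf z)$. The *locally dual method* with $P$, constants $\mu_t,L_t$ and starting point $\mathbf z^0$ performs $N$ steps of the fast gradient method on $\Psi_M$: $\mathbf z^{-1}=\mathbf z^0$, $\mathbf q=\mathbf z^k+\beta(\mathbf z^k-\mathbf z^{k-1})$, $\mathbf z^{k+1}=\mathbf q-\eta\nabla\Psi_M(\mathbf q)$, with $\eta=\mu_t/\lambda_{\max}(M)^2$, $\beta=\frac{s-1}{s+1}$, $s=\sqrt{L_t/\mu_t}\,\chi(M)$, and returns $\mathbf x^N=(I\otimes E)\nabla H^*((M\otimes I)\mathbf z^N)$. One evaluation of $\nabla h_i^*$ at every node counts as one dual-oracle call, and one exchange of vectors between neighbours (one multiplication by $\mathbf W$) as one communication; $P(W)$ is applied by Horner's scheme. The *plain* method has $P(x)=x$. The *Chebyshev accelerated* method has $P(x)=P_K(x)=1-T_K(\theta(x))/T_K(\theta(0))$,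 where $T_K$ is the Chebyshev polynomial, $K=\lceil\sqrt{2\chi(W)}\,\rceil$, and $\theta$ is the affine map with $\theta(\lambda_{\min}^+(W)/2)=1$, $\theta(\lambda_{\max}(W))=-1$. For $\gamma>0$ let $\mathbf A\mathbf x=(\mathbf B\mathbf x,\gamma\mathbf W\mathbf x)$. Call $\mathbf x$ *$\varepsilon$-accurate* if $F(\mathbf x)-F(\mathbf y)\le\varepsilon$ for every feasible $\mathbf y$ and $\|\mathbf A\mathbf x\|\le\varepsilon$. **Claim.** There is a universal constant $C>0$ such that in every such setting the following hold. 1. $d_t=d-\operatorname{rank}B$. The largest $\mu_t$ for which all $h_i$ are $\mu_t$-strongly convex and the least $L_t$ for which all $h_i$ are $L_t$-smooth exist, and $\mu_t\ge\mu$, $L_t\le L$. 2. $\sup_{\mathbf B\mathbf x=0}\{\langle\mathbf v,\mathbf x\rangle-F(\mathbf x)\}=H^*((I\otimes E^\top)\mathbf v)$ for all $\mathbf v\in\mathbb R^{md}$, and $\nabla H^*(\mathbf z)$ is the unique maximizer of $\langle\mathbf z,\mathbf t\rangle-H(\mathbf t)$. For $M=W$ and for $M=P_K(W)$, $\Psi_M$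 has a minimizer, and the minimum of the constrained problem is attained and equals $-\min\Psi_M$. For every polynomial $P$, multiplication by $P(W)\otimes I$ takes $\deg P$ communications, and the gradient that the method computes (by two such multiplications and one dual-oracle call) is $\nabla\Psi_{P(W)}$. 3. $\deg P_K\le C\sqrt{\chi(W)}$, $P_K(W)$ is positive semidefinite with the same kernel as $W$, and $\chi(P_K(W))\le C$. 4. Let $\mu_t>0$ and $L_t$ be any constants such that all $h_i$ are $\mu_t$-strongly convex and $L_t$-smooth (in particular the best ones). Then $H^*$ is $\frac1{\mu_t}$-smooth and $\frac1{L_t}$-strongly convex. 5. Let $\mu_t,L_t$ be as in 4, and let $\gamma>0$ and $0<\varepsilon\le1$. Let $\mathbf z^*$ be a minimizer of $\Psi_W$ with $\|\mathbf z^*\|\le R$ and $\|\mathbf z^0-\mathbf z^*\|\le R$. Then there is $N$ such that the plain method returns an $\varepsilon$-accurate point after any number $N'\ge N$ of steps, and its $N$ steps, including the computation of $\mathbf x^N$, use at most $$C\sqrt{\tfrac{L_t}{\mu_t}}\;\chi(W)\,\log\frac{2+\Theta}{\varepsilon},\qquad \Theta=\sqrt{\tfrac{L_t}{\mu_t}}\,\chi(W)\,\frac{\lambda_{\max}(W)^2}{\mu_t}\,R(R+\gamma),$$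 dual-oracle calls, and at most that many communications. That is $O\big(\sqrt{L_t/\mu_t}\,\chi(W)\log\frac1\varepsilon\big)$, up to the logarithmic dependence on the problem parameters. 6. Let $\mu_t,L_t,\gamma,\varepsilon$ be as in 5, and let $\mathbf z^*$ be a minimizer of $\Psi_{P_K(W)}$ with $\|\mathbf z^*\|\le R$ and $\|\mathbf z^0-\mathbf z^*\|\le R$. Then there is $N$ such that the Chebyshev accelerated method returns an $\varepsilon$-accurate point after any number $N'\ge N$ of steps, and its $N$ steps, including the computation of $\mathbf x^N$, use a number $\bar N$ of dual-oracle calls and a number of communications with $$\bar N\le C\sqrt{\tfrac{L_t}{\mu_t}}\,\log\frac{2+\Theta'}{\varepsilon},\quad \Theta'=\sqrt{\tfrac{L_t}{\mu_t}}\,\frac{1}{\mu_t}\,R\big(R+\gamma\lambda_{\max}(W)\big),\qquad \#\text{communications}\le C\,\bar N\sqrt{\chi(W)} .$$ That is, $\bar N=O\big(\sqrt{L_t/\mu_t}\log\frac1\varepsilon\big)$ oracle calls, up to the logarithmic dependence on the problem parameters, and $O(\bar N\sqrt{\chi(W)})$ communications. -/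

import Mathlib

open scoped RealInnerProductSpace

namespace LocallyDual

noncomputable section

/-- `ℝⁿ` with the Euclidean norm. -/
abbrev Vec (n : ℕ) : Type := EuclideanSpace ℝ (Fin n)

/-- Stacked vectors `col(x₁, …, x_m)` with blocks in `ℝⁿ`, with the Euclidean norm of `ℝ^{mn}`. -/
abbrev Stack (m n : ℕ) : Type := PiLp 2 (fun _ : Fin m => Vec n)

section Functions

variable {X : Type} [NormedAddCommGroup X] [InnerProductSpace ℝ X] [CompleteSpace X]

/-- A differentiable `c`-strongly convex function. -/
def StronglyConvexWith (c : ℝ) (g : X → ℝ) : Prop :=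
  Differentiable ℝ g ∧
    ∀ x y, g x + ⟪gradient g x, y - x⟫ + c / 2 * ‖y - x‖ ^ 2 ≤ g y

/-- A differentiable `c`-smooth function. -/
def SmoothWith (c : ℝ) (g : X → ℝ) : Prop :=
  Differentiable ℝ g ∧
    ∀ x y, g y ≤ g x + ⟪gradient g x, y - x⟫ + c / 2 * ‖y - x‖ ^ 2

/-- The convex conjugate `g*(z) = sup_t {⟨z, t⟩ - g t}`. -/
def conjugate (g : X → ℝ) (z : X) : ℝ := ⨆ t, (⟪z, t⟫ - g t)

end Functions

section Matrices

variable {m n k : ℕ}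

/-- Maximal eigenvalue of a symmetric positive semidefinite matrix. -/
def lamMax (M : Matrix (Fin m) (Fin m) ℝ) : ℝ := sSup (spectrum ℝ M)

/-- Minimal nonzero eigenvalue of a symmetric positive semidefinite matrix. -/
def lamMinPos (M : Matrix (Fin m) (Fin m) ℝ) : ℝ := sInf (spectrum ℝ M \ {0})

/-- The condition number `χ(M) = λ_max(M) / λ_min⁺(M)`. -/
def chi (M : Matrix (Fin m) (Fin m) ℝ) : ℝ := lamMax M / lamMinPos M

/-- The action of `M ⊗ I` on stacked vectors. -/
def kronAct (M : Matrix (Fin m) (Fin m) ℝ) (z : Stack m n) : Stack m n :=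
  WithLp.toLp 2 fun i => ∑ j, M i j • z j

/-- The action of `I ⊗ D` on stacked vectors: every block is multiplied by `D`. -/
def blockAct (D : Matrix (Fin k) (Fin n) ℝ) (z : Stack m n) : Stack m k :=
  WithLp.toLp 2 fun i => Matrix.toEuclideanLin D (z i)

/-- The stacked constraint operator `A x = (B x, γ W x)`, with `B`, `W` acting as `I ⊗ B`,
`W ⊗ I`. -/
def constraintMap (B : Matrix (Fin k) (Fin n) ℝ) (W : Matrix (Fin m) (Fin m) ℝ) (γ : ℝ)
    (x : Stack m n) : WithLp 2 (Stack m k × Stack m n) :=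
  WithLp.toLp 2 (blockAct B x, γ • kronAct W x)

/-- `W` is a mixing matrix of the graph `G`. -/
structure IsMixing (G : SimpleGraph (Fin m)) (W : Matrix (Fin m) (Fin m) ℝ) : Prop where
  posSemidef : W.PosSemidef
  compatible : ∀ i j, i ≠ j → ¬ G.Adj i j → W i j = 0
  kernel : ∀ v : Fin m → ℝ, W.mulVec v = 0 ↔ ∀ i j, v i = v j

/-- The columns of `E` form an orthonormal basis of `ker B`. -/
structure IsKernelBasis (B : Matrix (Fin k) (Fin n) ℝ) {r : ℕ}
    (E : Matrix (Fin n) (Fin r) ℝ) : Prop where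
  orthonormal : E.transpose * E = 1
  range_eq : ∀ x : Fin n → ℝ, B.mulVec x = 0 ↔ ∃ t, E.mulVec t = x

/-- The Chebyshev polynomial `P_K(x) = 1 - T_K(θ(x)) / T_K(θ(0))` with `K = ⌈√(2χ(W))⌉`, where `θ`
is the affine map that sends `b` to `-1` and `a` to `1`, for `a = λ_min⁺(W) / 2` and
`b = λ_max(W)`. Halving the lower end of the spectral interval keeps `a < b` when `χ(W) = 1`. -/
def chebPoly (W : Matrix (Fin m) (Fin m) ℝ) : Polynomial ℝ :=
  let a := lamMinPos W / 2
  let b := lamMax W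
  let K : ℕ := ⌈√(2 * chi W)⌉₊
  let T := Polynomial.Chebyshev.T ℝ (K : ℤ)
  1 - Polynomial.C (T.eval ((b + a) / (b - a)))⁻¹ *
    T.comp (Polynomial.C ((b + a) / (b - a)) - Polynomial.C (2 / (b - a)) * Polynomial.X)

end Matrices

section Problem

variable {m d p r : ℕ}

/-- The separable sum `(x₁, …, x_m) ↦ ∑ᵢ gᵢ(xᵢ)`. -/
def sepSum (g : Fin m → Vec d → ℝ) (x : Stack m d) : ℝ := ∑ i, g i (x i)

/-- The reparametrized local objectives `hᵢ(t) = fᵢ(E t)`. -/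
def reparam (f : Fin m → Vec d → ℝ) (E : Matrix (Fin d) (Fin r) ℝ) (i : Fin m) (t : Vec r) : ℝ :=
  f i (Matrix.toEuclideanLin E t)

/-- The dual objective `z ↦ H*(M z)`, where `H(t) = ∑ᵢ hᵢ(tᵢ)` and the consensus constraint is
written as `(M ⊗ I) t = 0`. -/
def dualObj (h : Fin m → Vec r → ℝ) (M : Matrix (Fin m) (Fin m) ℝ) (z : Stack m r) : ℝ :=
  conjugate (sepSum h) (kronAct M z)

/-- Feasible points of `min F(x)` subject to `W x = 0`, `B x = 0`. -/
def feasible (B : Matrix (Fin p) (Fin d) ℝ) (W : Matrix (Fin m) (Fin m) ℝ) : Set (Stack m d) :=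
  {x | kronAct W x = 0 ∧ blockAct B x = 0}

/-- `x` satisfies `F(x) - F(y) ≤ ε` for every feasible `y`, and `‖A x‖ ≤ ε`. -/
def IsAccurate (f : Fin m → Vec d → ℝ) (B : Matrix (Fin p) (Fin d) ℝ)
    (W : Matrix (Fin m) (Fin m) ℝ) (γ ε : ℝ) (x : Stack m d) : Prop :=
  (∀ y ∈ feasible B W, sepSum f x - sepSum f y ≤ ε) ∧ ‖constraintMap B W γ x‖ ≤ ε

end Problem

/-! Decentralized computations with a count of oracle calls (per node) and of communication
rounds. Costs arise only in `dualOracle` and `gossip`; everything else is local arithmetic. -/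

/-- A result together with the number of oracle calls made at each node and the number of
communication rounds that were used to compute it. -/
structure Counted (α : Type) where
  val : α
  oracleCalls : ℕ
  communications : ℕ

instance : Monad Counted where
  pure a := ⟨a, 0, 0⟩
  bind c k := ⟨(k c.val).val, c.oracleCalls + (k c.val).oracleCalls,
    c.communications + (k c.val).communications⟩

section Algorithm

variable {m d r : ℕ}

/-- Every node `i` calls its dual oracle `∇hᵢ*` once, at its own block. -/
def dualOracle (h : Fin m → Vec r → ℝ) (z : Stack m r) : Counted (Stack m r) :=
  ⟨WithLp.toLp 2 fun i => gradient (conjugate (h i)) (z i), 1, 0⟩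

open Classical in
/-- One communication round: every node receives the blocks of its neighbours in `G` and combines
them with its own block, with the weights in its row of `W`. -/
def gossip (G : SimpleGraph (Fin m)) (W : Matrix (Fin m) (Fin m) ℝ) (z : Stack m r) :
    Counted (Stack m r) :=
  ⟨WithLp.toLp 2 fun i => W i i • z i + ∑ j, if G.Adj i j then W i j • z j else 0, 0, 1⟩

/-- Horner's scheme, one communication round per step. -/
def hornerLoop (G : SimpleGraph (Fin m)) (W : Matrix (Fin m) (Fin m) ℝ) (P : Polynomial ℝ)
    (v : Stack m r) : ℕ → Stack m r → Counted (Stack m r)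
  | 0, y => pure y
  | k + 1, y => do
    let u ← gossip G W y
    hornerLoop G W P v k (u + P.coeff k • v)

/-- Decentralized multiplication by `P(W) ⊗ I`. -/
def polyGossip (G : SimpleGraph (Fin m)) (W : Matrix (Fin m) (Fin m) ℝ) (P : Polynomial ℝ)
    (v : Stack m r) : Counted (Stack m r) :=
  hornerLoop G W P v P.natDegree (P.leadingCoeff • v)

/-- Decentralized evaluation of the gradient of the dual objective `z ↦ H*(P(W) z)`. -/
def dualGrad (G : SimpleGraph (Fin m)) (W : Matrix (Fin m) (Fin m) ℝ) (P : Polynomial ℝ)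
    (h : Fin m → Vec r → ℝ) (z : Stack m r) : Counted (Stack m r) := do
  let q ← polyGossip G W P z
  let t ← dualOracle h q
  polyGossip G W P t

/-- The fast gradient method with step size `η` and momentum `β`, from the last two iterates. -/
def fastGradientLoop (grad : Stack m r → Counted (Stack m r)) (η β : ℝ) :
    ℕ → Stack m r → Stack m r → Counted (Stack m r)
  | 0, _, z => pure z
  | k + 1, zPrev, z => do
    let q := z + β • (z - zPrev)
    let g ← grad q
    fastGradientLoop grad η β k z (q - η • g)

/-- The locally dual method: `N` steps of the fast gradient method for the dual objective
`z ↦ H*(M z)`, `M = P(W)`, started at `z⁰`, and then the primal point `E t` with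
`t = ∇H*(M z^N)`. The dual objective is `λ_max(M)²/μ_t`-smooth and has condition number
`(L_t/μ_t) χ(M)²` on the orthogonal complement of the kernel of `M`. Taking `P(x) = x` gives the
plain method, and `P = chebPoly W` the Chebyshev accelerated one. -/
def locallyDual (G : SimpleGraph (Fin m)) (W : Matrix (Fin m) (Fin m) ℝ) (P : Polynomial ℝ)
    (f : Fin m → Vec d → ℝ) (E : Matrix (Fin d) (Fin r) ℝ) (μt Lt : ℝ) (z₀ : Stack m r) (N : ℕ) :
    Counted (Stack m d) := do
  let M := Polynomial.aeval W P
  let s := √(Lt / μt) * chi M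
  let z ← fastGradientLoop (dualGrad G W P (reparam f E))
    (μt / lamMax M ^ 2) ((s - 1) / (s + 1)) N z₀ z₀
  let q ← polyGossip G W P z
  let t ← dualOracle (reparam f E) q
  pure (blockAct E t)

end Algorithm

end

end LocallyDual

open LocallyDual

/-! The columns of `E` are orthonormal and span ker B, so x = (I⊗E)t is an isometric parametrization
of {Bx = 0}. It removes the local constraint without worsening the constants of the objective. What
remains is min H(t) with (M⊗I)t = 0, for any symmetric M with the kernel of W, and its dual
objective is Ψ(z) = H*(Mz).

For a strongly convex g, ∇g is a bijection with inverse ∇g*, and the Bregman divergence of g* is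
that of g with the arguments exchanged. This turns μ_t-strong convexity and L_t-smoothness of H into
1/μ_t-smoothness and 1/L_t-strong convexity of H*. Hence Ψ is λ_max(M)²/μ_t-smooth, and
λ_min⁺(M)²/L_t-strongly convex modulo ker M. Its gradients lie in range M = (ker M)ᗮ, so a Lyapunov
argument run in the projection to (ker M)ᗮ gives the factor 1 - 1/s per step, s = √(L_t/μ_t) χ(M)
(`fastGradientIter_le`).

Primal accuracy follows from dual accuracy (`fastGradientIter_dual`). For t = ∇H*(Mz) the consensus
residual Mt is exactly ∇Ψ(z), which is bounded by the square root of the dual gap, and H(t) + min Ψ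
≤ ⟨z, ∇Ψ(z)⟩. Both decay like exp(-N/(2s)), so N of order s log((2+Θ)/ε) suffices.

For the accelerated method, T_K(θ(0)) ≥ 3 while |T_K| ≤ 1 on the image of the nonzero spectrum. So
P_K(W) has its nonzero eigenvalues in [2/3, 4/3] and χ(P_K(W)) ≤ 2, at a degree of order √χ(W). The
residual is carried back from P_K(W) to W through the common kernel (`norm_kronAct_le_of_ker_eq`).
-/

namespace LocallyDual

/-! ### Conjugates of strongly convex and smooth functions -/

section ConvexAnalysis

variable {X : Type} [NormedAddCommGroup X] [InnerProductSpace ℝ X] [CompleteSpace X]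

theorem gradient_eq_zero_of_isLocalMin {g : X → ℝ} {t : X} (h : IsLocalMin g t) :
    gradient g t = 0 := by
  rw [gradient, h.fderiv_eq_zero, map_zero]

theorem hasGradientAt_sub_inner {g : X → ℝ} {t : X} (hg : DifferentiableAt ℝ g t) (z : X) :
    HasGradientAt (fun t => g t - ⟪z, t⟫) (gradient g t - z) t := by
  rw [hasGradientAt_iff_hasFDerivAt, map_sub]
  exact (hasGradientAt_iff_hasFDerivAt.1 hg.hasGradientAt).sub
    ((InnerProductSpace.toDual ℝ X z).hasFDerivAt)

theorem StronglyConvexWith.isMaxOn_iff {c : ℝ} {g : X → ℝ} (hg : StronglyConvexWith c g)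
    (hc : 0 < c) {z t : X} :
    IsMaxOn (fun t' => ⟪z, t'⟫ - g t') Set.univ t ↔ gradient g t = z := by
  constructor
  · intro h
    have hmin : IsLocalMin (fun t => g t - ⟪z, t⟫) t := by
      refine Filter.Eventually.of_forall fun y => ?_
      have := h (Set.mem_univ y)
      simp only [Set.mem_ofPred_eq] at this
      linarith
    have h0 := gradient_eq_zero_of_isLocalMin hmin
    rw [(hasGradientAt_sub_inner (hg.1 t) z).gradient] at h0
    exact sub_eq_zero.1 h0
  · rintro rfl y -
    have h := hg.2 t y
    rw [inner_sub_right] at h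
    have : 0 ≤ c / 2 * ‖y - t‖ ^ 2 := by positivity
    simp only [Set.mem_ofPred_eq]
    linarith

theorem StronglyConvexWith.tendsto_cocompact [FiniteDimensional ℝ X] {c : ℝ} {g : X → ℝ}
    (hg : StronglyConvexWith c g) (hc : 0 < c) :
    Filter.Tendsto g (Filter.cocompact X) Filter.atTop := by
  have h1 : Filter.Tendsto (fun x : X => ‖x‖ * (c / 2 * ‖x‖ - ‖gradient g 0‖) + g 0)
      (Filter.cocompact X) Filter.atTop := by
    refine Filter.tendsto_atTop_add_const_right _ _ ?_
    have hn := tendsto_norm_cocompact_atTop (E := X)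
    refine hn.atTop_mul_atTop₀ ?_
    exact Filter.tendsto_atTop_add_const_right _ _ (hn.const_mul_atTop (by positivity))
  refine Filter.tendsto_atTop_mono (fun x => ?_) h1
  have h := hg.2 0 x
  rw [sub_zero] at h
  have h2 := neg_le_of_abs_le (abs_real_inner_le_norm (gradient g 0) x)
  nlinarith

theorem StronglyConvexWith.sub_inner {c : ℝ} {g : X → ℝ} (hg : StronglyConvexWith c g) (z : X) :
    StronglyConvexWith c (fun t => g t - ⟪z, t⟫) := by
  refine ⟨fun t => (hasGradientAt_sub_inner (hg.1 t) z).differentiableAt, fun x y => ?_⟩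
  rw [(hasGradientAt_sub_inner (hg.1 x) z).gradient, inner_sub_left]
  have h := hg.2 x y
  rw [inner_sub_right z]
  linarith

/-- Coercivity yields a minimizer of g - ⟨z, ·⟩, whose gradient there is z. Every dual point can
thus be written as `gradient g t`, which is how the conjugate is handled below. -/
theorem StronglyConvexWith.gradient_surjective [FiniteDimensional ℝ X] {c : ℝ} {g : X → ℝ}
    (hg : StronglyConvexWith c g) (hc : 0 < c) : Function.Surjective (gradient g) := by
  intro z
  obtain ⟨t, ht⟩ := (hg.sub_inner z).1.continuous.exists_forall_le
    ((hg.sub_inner z).tendsto_cocompact hc)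
  refine ⟨t, (hg.isMaxOn_iff hc).1 fun y _ => ?_⟩
  have := ht y
  simp only [Set.mem_ofPred_eq]
  linarith

/-- A real supremum has a default value on unbounded sets; attainment at t with ∇g(t) = z rules this
case out. -/
theorem StronglyConvexWith.isLUB_conjugate [FiniteDimensional ℝ X] {c : ℝ} {g : X → ℝ}
    (hg : StronglyConvexWith c g) (hc : 0 < c) (z : X) :
    IsLUB (Set.range fun t => ⟪z, t⟫ - g t) (conjugate g z) := by
  obtain ⟨t, rfl⟩ := hg.gradient_surjective hc z
  refine isLUB_ciSup ⟨⟪gradient g t, t⟫ - g t, ?_⟩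
  rintro _ ⟨y, rfl⟩
  exact (hg.isMaxOn_iff hc).2 rfl (Set.mem_univ y)

theorem StronglyConvexWith.conjugate_gradient [FiniteDimensional ℝ X] {c : ℝ} {g : X → ℝ}
    (hg : StronglyConvexWith c g) (hc : 0 < c) (t : X) :
    conjugate g (gradient g t) = ⟪gradient g t, t⟫ - g t := by
  refine (hg.isLUB_conjugate hc _).unique (IsGreatest.isLUB ⟨⟨t, rfl⟩, ?_⟩)
  rintro _ ⟨y, rfl⟩
  exact (hg.isMaxOn_iff hc).2 rfl (Set.mem_univ y)

/-- Gradient descent from `x` with step `1 / L` lowers an `L`-smooth function. -/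
theorem SmoothWith.apply_sub_le {L : ℝ} {g : X → ℝ} (hg : SmoothWith L g) (hL : 0 < L) (x u : X) :
    g (x - L⁻¹ • u) ≤ g x - ⟪gradient g x, u⟫ / L + ‖u‖ ^ 2 / (2 * L) := by
  have h := hg.2 x (x - L⁻¹ • u)
  rw [sub_sub_cancel_left, inner_neg_right, inner_smul_right, norm_neg, norm_smul, mul_pow,
    Real.norm_eq_abs, sq_abs] at h
  refine h.trans (le_of_eq ?_)
  field_simp
  ring

/-- The function g - ⟨∇g(x), ·⟩ is minimized at x, and a gradient step of length 1/L from y lowers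
it by at least ‖u‖²/(2L). Of strong convexity only convexity enters. -/
theorem bregman_ge_of_smooth {c L : ℝ} {g : X → ℝ} (hg : StronglyConvexWith c g) (hc : 0 < c)
    (hs : SmoothWith L g) (hL : 0 < L) (x y : X) :
    g x + ⟪gradient g x, y - x⟫ + 1 / L / 2 * ‖gradient g y - gradient g x‖ ^ 2 ≤ g y := by
  set u := gradient g y - gradient g x with hu
  have h1 := hs.apply_sub_le hL y u
  have h2 := hg.2 x (y - L⁻¹ • u)
  have h3 : 0 ≤ c / 2 * ‖y - L⁻¹ • u - x‖ ^ 2 := by positivity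
  have h4 : y - L⁻¹ • u - x = (y - x) - L⁻¹ • u := by abel
  rw [h4, inner_sub_right, inner_smul_right, ← h4] at h2
  have h5 : ⟪gradient g y, u⟫ = ⟪gradient g x, u⟫ + ‖u‖ ^ 2 := by
    rw [← real_inner_self_eq_norm_sq, ← inner_add_left, hu]
    congr 1
    abel
  rw [h5] at h1
  have h6 : (⟪gradient g x, u⟫ + ‖u‖ ^ 2) / L = L⁻¹ * ⟪gradient g x, u⟫ + ‖u‖ ^ 2 / L := by
    field_simp
  have h7 : ‖u‖ ^ 2 / L = 1 / L / 2 * ‖u‖ ^ 2 + ‖u‖ ^ 2 / (2 * L) := by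
    field_simp
    ring
  linarith

theorem hasGradientAt_of_abs_sub_le {g : X → ℝ} {z t : X} {K : ℝ}
    (h : ∀ w, |g w - g z - ⟪t, w - z⟫| ≤ K * ‖w - z‖ ^ 2) : HasGradientAt g t z := by
  rw [hasGradientAt_iff_isLittleO]
  have h1 : (fun w => g w - g z - ⟪t, w - z⟫) =O[nhds z] fun w => ‖w - z‖ ^ 2 := by
    refine Asymptotics.IsBigO.of_bound K (Filter.Eventually.of_forall fun w => ?_)
    rw [Real.norm_eq_abs, Real.norm_of_nonneg (by positivity)]
    exact h w
  exact h1.trans_isLittleO (Asymptotics.isLittleO_norm_pow_id (one_lt_two) |>.comp_tendsto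
    (k := fun w => w - z) (by simpa using (continuous_sub_right z).tendsto z))

/-- The Bregman divergence of the conjugate is the reversed Bregman divergence. -/
theorem StronglyConvexWith.conjugate_bregman [FiniteDimensional ℝ X] {c : ℝ} {g : X → ℝ}
    (hg : StronglyConvexWith c g) (hc : 0 < c) (t u : X) :
    conjugate g (gradient g u) - conjugate g (gradient g t) -
      ⟪t, gradient g u - gradient g t⟫ = g t - g u - ⟪gradient g u, t - u⟫ := by
  rw [hg.conjugate_gradient hc, hg.conjugate_gradient hc, inner_sub_right, inner_sub_right,
    real_inner_comm t (gradient g u), real_inner_comm t (gradient g t)]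
  ring

/-- After the divergence is reversed, strong convexity at t leaves ‖w‖‖u - t‖ - (c/2)‖u - t‖², and
completing the square bounds this by ‖w‖²/(2c). -/
theorem StronglyConvexWith.conjugate_bregman_le [FiniteDimensional ℝ X] {c : ℝ} {g : X → ℝ}
    (hg : StronglyConvexWith c g) (hc : 0 < c) (t u : X) :
    conjugate g (gradient g u) - conjugate g (gradient g t) -
      ⟪t, gradient g u - gradient g t⟫ ≤ 1 / c / 2 * ‖gradient g u - gradient g t‖ ^ 2 := by
  rw [hg.conjugate_bregman hc]
  have h := hg.2 t u
  set w := gradient g u - gradient g t with hw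
  have h1 : ⟪gradient g u, t - u⟫ = ⟪w, t - u⟫ - ⟪gradient g t, u - t⟫ := by
    rw [hw, inner_sub_left, ← neg_sub t u, inner_neg_right]
    ring
  have h2 := neg_le_of_abs_le (abs_real_inner_le_norm w (t - u))
  rw [norm_sub_rev t u] at h2
  have h3 : 1 / c / 2 * ‖w‖ ^ 2 + c / 2 * ‖u - t‖ ^ 2 - ‖w‖ * ‖u - t‖ =
      (‖w‖ - c * ‖u - t‖) ^ 2 / (2 * c) := by
    field_simp
    ring
  have h4 : 0 ≤ (‖w‖ - c * ‖u - t‖) ^ 2 / (2 * c) := by positivity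
  linarith

/-- The remainder of g* at ∇g(t), with slope t, is a Bregman divergence of g: nonnegative by
convexity and at most quadratic. -/
theorem StronglyConvexWith.hasGradientAt_conjugate [FiniteDimensional ℝ X] {c : ℝ} {g : X → ℝ}
    (hg : StronglyConvexWith c g) (hc : 0 < c) (t : X) :
    HasGradientAt (conjugate g) t (gradient g t) := by
  refine hasGradientAt_of_abs_sub_le (K := 1 / c / 2) fun w => ?_
  obtain ⟨u, rfl⟩ := hg.gradient_surjective hc w
  rw [abs_of_nonneg]
  · exact hg.conjugate_bregman_le hc t u
  · rw [hg.conjugate_bregman hc]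
    have h := hg.2 u t
    have : 0 ≤ c / 2 * ‖t - u‖ ^ 2 := by positivity
    linarith

theorem StronglyConvexWith.gradient_conjugate [FiniteDimensional ℝ X] {c : ℝ} {g : X → ℝ}
    (hg : StronglyConvexWith c g) (hc : 0 < c) (t : X) :
    gradient (conjugate g) (gradient g t) = t :=
  (hg.hasGradientAt_conjugate hc t).gradient

theorem StronglyConvexWith.gradient_gradient_conjugate [FiniteDimensional ℝ X] {c : ℝ} {g : X → ℝ}
    (hg : StronglyConvexWith c g) (hc : 0 < c) (z : X) :
    gradient g (gradient (conjugate g) z) = z := by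
  obtain ⟨t, rfl⟩ := hg.gradient_surjective hc z
  rw [hg.gradient_conjugate hc]

theorem StronglyConvexWith.differentiable_conjugate [FiniteDimensional ℝ X] {c : ℝ} {g : X → ℝ}
    (hg : StronglyConvexWith c g) (hc : 0 < c) : Differentiable ℝ (conjugate g) := by
  intro z
  obtain ⟨t, rfl⟩ := hg.gradient_surjective hc z
  exact (hg.hasGradientAt_conjugate hc t).differentiableAt

theorem StronglyConvexWith.smoothWith_conjugate [FiniteDimensional ℝ X] {c : ℝ} {g : X → ℝ}
    (hg : StronglyConvexWith c g) (hc : 0 < c) : SmoothWith (1 / c) (conjugate g) := by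
  refine ⟨hg.differentiable_conjugate hc, fun z w => ?_⟩
  obtain ⟨t, rfl⟩ := hg.gradient_surjective hc z
  obtain ⟨u, rfl⟩ := hg.gradient_surjective hc w
  have h := hg.conjugate_bregman_le hc t u
  rw [hg.gradient_conjugate hc]
  linarith

theorem SmoothWith.stronglyConvexWith_conjugate [FiniteDimensional ℝ X] {c L : ℝ} {g : X → ℝ}
    (hs : SmoothWith L g) (hL : 0 < L) (hg : StronglyConvexWith c g) (hc : 0 < c) :
    StronglyConvexWith (1 / L) (conjugate g) := by
  refine ⟨hg.differentiable_conjugate hc, fun z w => ?_⟩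
  obtain ⟨t, rfl⟩ := hg.gradient_surjective hc z
  obtain ⟨u, rfl⟩ := hg.gradient_surjective hc w
  have h := hg.conjugate_bregman hc t u
  have h2 := bregman_ge_of_smooth hg hc hs hL u t
  rw [hg.gradient_conjugate hc]
  rw [norm_sub_rev] at h2
  linarith

theorem StronglyConvexWith.le_of_smoothWith [Nontrivial X] {c L : ℝ} {g : X → ℝ}
    (hg : StronglyConvexWith c g) (hs : SmoothWith L g) : c ≤ L := by
  obtain ⟨y, hy⟩ := exists_ne (0 : X)
  have h1 := hg.2 0 y
  have h2 := hs.2 0 y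
  have h3 : 0 < ‖y - 0‖ ^ 2 := by
    rw [sub_zero]
    have := norm_pos_iff.2 hy
    positivity
  nlinarith

theorem HasGradientAt.comp_symmetric {g : X → ℝ} {T : X →L[ℝ] X} (hT : ∀ x y, ⟪T x, y⟫ = ⟪x, T y⟫)
    {z g' : X} (hg : HasGradientAt g g' (T z)) : HasGradientAt (fun z => g (T z)) (T g') z := by
  rw [hasGradientAt_iff_hasFDerivAt] at hg ⊢
  refine (hg.comp z T.hasFDerivAt).congr_fderiv ?_
  ext y
  simp [hT]

end ConvexAnalysis

/-! ### Linear convergence of the fast gradient method -/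

section FastGradient

variable {X : Type} [NormedAddCommGroup X] [InnerProductSpace ℝ X]

/-- One step of the fast gradient method contracts the Lyapunov function. -/
theorem fastGradient_step {s L c φx φy φp φs : ℝ} {x y v xs g : X} (hs : 1 ≤ s) (hL : 0 < L)
    (hc : c = L / s ^ 2) (hy : x - y = s⁻¹ • (y - v))
    (hp : φp ≤ φy - 1 / (2 * L) * ‖g‖ ^ 2) (hx : φy + ⟪g, x - y⟫ ≤ φx)
    (hm : φy + ⟪g, xs - y⟫ + c / 2 * ‖xs - y‖ ^ 2 ≤ φs) :
    φp - φs + c / 2 * ‖x + s • (y - L⁻¹ • g - x) - xs‖ ^ 2 ≤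
      (1 - 1 / s) * (φx - φs + c / 2 * ‖v - xs‖ ^ 2) := by
  have hs0 : 0 < s := by linarith
  set a := v - xs with ha
  set b := y - xs with hb
  set σ := s⁻¹ with hσ
  have hσ0 : 0 < σ := by positivity
  have hσ1 : σ ≤ 1 := inv_le_one_of_one_le₀ hs
  have hsσ : s * σ = 1 := mul_inv_cancel₀ hs0.ne'
  have e1 : x - y = σ • (b - a) := by rw [hy, ha, hb]; congr 1; abel
  have e2 : xs - y = -b := by rw [hb]; abel
  have e3 : x + s • (y - L⁻¹ • g - x) - xs = (1 - σ) • a + σ • b - (s * L⁻¹) • g := by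
    have : x = b + σ • (b - a) + xs := by rw [← e1, hb]; abel
    have hy' : y = b + xs := by rw [hb]; abel
    rw [this, hy']
    linear_combination (norm := module) -hsσ • (b - a)
  have n1 : ‖(1 - σ) • a + σ • b - (s * L⁻¹) • g‖ ^ 2 =
      (1 - σ) ^ 2 * ⟪a, a⟫ + 2 * (1 - σ) * σ * ⟪a, b⟫ + σ ^ 2 * ⟪b, b⟫
        - 2 * (s * L⁻¹) * ((1 - σ) * ⟪g, a⟫ + σ * ⟪g, b⟫) + (s * L⁻¹) ^ 2 * ⟪g, g⟫ := by
    rw [← real_inner_self_eq_norm_sq]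
    simp only [inner_add_left, inner_add_right, inner_sub_left, inner_sub_right,
      real_inner_smul_left, real_inner_smul_right]
    rw [real_inner_comm a b, real_inner_comm a g, real_inner_comm b g]
    ring
  have n2 : 0 ≤ ⟪a, a⟫ - 2 * ⟪a, b⟫ + ⟪b, b⟫ := by
    have h := real_inner_self_nonneg (x := a - b)
    simp only [inner_sub_left, inner_sub_right] at h
    rw [real_inner_comm a b] at h
    linarith
  rw [e3, n1]
  rw [e1, inner_smul_right, inner_sub_right] at hx
  rw [e2, inner_neg_right, norm_neg, ← real_inner_self_eq_norm_sq] at hm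
  rw [← real_inner_self_eq_norm_sq] at hp ⊢
  have hc' : c = L * σ ^ 2 := by rw [hc, hσ]; field_simp
  have hLi : L * L⁻¹ = 1 := mul_inv_cancel₀ hL.ne'
  have hp' : φp ≤ φy - L⁻¹ / 2 * ⟪g, g⟫ := by
    refine hp.trans (le_of_eq ?_)
    field_simp
  have k1 : c / 2 * (2 * (s * L⁻¹) * ((1 - σ) * ⟪g, a⟫ + σ * ⟪g, b⟫)) =
      σ * ((1 - σ) * ⟪g, a⟫ + σ * ⟪g, b⟫) := by
    rw [hc']
    linear_combination (σ * ((1 - σ) * ⟪g, a⟫ + σ * ⟪g, b⟫)) * (s * σ * hLi + hsσ)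
  have k2 : c / 2 * ((s * L⁻¹) ^ 2 * ⟪g, g⟫) = L⁻¹ / 2 * ⟪g, g⟫ := by
    rw [hc']
    linear_combination (L⁻¹ / 2 * ⟪g, g⟫) * ((s * σ) ^ 2 * hLi + (s * σ + 1) * hsσ)
  have k3 : 0 ≤ c / 2 * (σ * (1 - σ) * (⟪a, a⟫ - 2 * ⟪a, b⟫ + ⟪b, b⟫)) := by
    have : 0 ≤ 1 - σ := by linarith
    have : 0 ≤ c := by rw [hc']; positivity
    positivity
  -- The bounds at x and at the minimizer get the weights 1 - σ and σ. Then the terms linear in g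
  -- cancel by `k1`, those in ‖g‖² cancel by `k2`, and the remaining quadratic form in a, b is the
  -- nonnegative quantity `k3`.
  have k4 := mul_le_mul_of_nonneg_left hx (show 0 ≤ 1 - σ by linarith)
  have k5 := mul_le_mul_of_nonneg_left hm hσ0.le
  rw [one_div]
  linarith

/-- The fast gradient method with step size `η` and momentum `β`, from the last two iterates. -/
def fastGradientIter (grad : X → X) (η β : ℝ) : ℕ → X → X → X
  | 0, _, z => z
  | k + 1, w, z => fastGradientIter grad η β k z
      (z + β • (z - w) - η • grad (z + β • (z - w)))

/-- Linear convergence of the fast gradient method for a function that is strongly convex with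
respect to the seminorm `‖Q ·‖`. -/
theorem fastGradientIter_le {s L c : ℝ} {Ψ : X → ℝ} {grad : X → X} {Q : X →ₗ[ℝ] X} (hs : 1 ≤ s)
    (hL : 0 < L) (hc : c = L / s ^ 2)
    (hdesc : ∀ y, Ψ (y - L⁻¹ • grad y) ≤ Ψ y - 1 / (2 * L) * ‖grad y‖ ^ 2)
    (hconv : ∀ x y, Ψ y + ⟪grad y, Q (x - y)⟫ + c / 2 * ‖Q (x - y)‖ ^ 2 ≤ Ψ x)
    (hQ : ∀ y, Q (grad y) = grad y) (zs : X) (N : ℕ) (w z : X) :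
    Ψ (fastGradientIter grad L⁻¹ ((s - 1) / (s + 1)) N w z) - Ψ zs ≤
      (1 - 1 / s) ^ N * (Ψ z - Ψ zs + c / 2 * ‖Q (w + s • (z - w) - zs)‖ ^ 2) := by
  have hs0 : 0 < s := by linarith
  have hc0 : 0 ≤ c := by rw [hc]; positivity
  induction N generalizing w z with
  | zero =>
    have : 0 ≤ c / 2 * ‖Q (w + s • (z - w) - zs)‖ ^ 2 := by positivity
    simp only [fastGradientIter, pow_zero, one_mul]
    linarith
  | succ N ih =>
    refine (ih _ _).trans ?_
    rw [pow_succ (1 - 1 / s), mul_assoc]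
    have hρ : 0 ≤ 1 - 1 / s := by
      rw [sub_nonneg, div_le_one hs0]
      exact hs
    refine mul_le_mul_of_nonneg_left ?_ (pow_nonneg hρ N)
    set y := z + ((s - 1) / (s + 1)) • (z - w) with hy
    have key := fastGradient_step (x := Q z) (y := Q y) (v := Q (w + s • (z - w))) (xs := Q zs)
      (g := grad y) hs hL hc ?_ (hdesc y) (φx := Ψ z) ?_ (φs := Ψ zs) ?_
    · have e1 : Q (z + s • (y - L⁻¹ • grad y - z) - zs) =
          Q z + s • (Q y - L⁻¹ • grad y - Q z) - Q zs := by
        simp only [map_sub, map_add, map_smul, hQ]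
      rw [e1, map_sub]
      exact key
    · rw [← map_sub, ← map_sub, ← map_smul]
      congr 1
      -- The momentum β = (s-1)/(s+1) solves s⁻¹(β + 1 - s) = -β, which is the relation between z, y
      -- and the auxiliary point w + s(z - w) required by the one-step estimate.
      have h5 : s⁻¹ * ((s - 1) / (s + 1) + 1 - s) = - ((s - 1) / (s + 1)) := by
        field_simp
        ring
      rw [hy]
      linear_combination (norm := module) -h5 • (z - w)
    · rw [← map_sub]
      have := hconv z y
      have : 0 ≤ c / 2 * ‖Q (z - y)‖ ^ 2 := by positivity
      linarith
    · rw [← map_sub]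
      exact hconv zs y

end FastGradient

/-! ### Projection along the kernel of an operator -/

section Coimage

variable {X : Type} [NormedAddCommGroup X] [InnerProductSpace ℝ X] [CompleteSpace X]

/-- The projection onto the orthogonal complement of the kernel. -/
noncomputable def coimageProj (T : X →L[ℝ] X) : X →ₗ[ℝ] X :=
  ((LinearMap.ker T.toLinearMap)ᗮ.starProjection).toLinearMap

theorem coimageProj_mem (T : X →L[ℝ] X) (z : X) :
    coimageProj T z ∈ (LinearMap.ker T.toLinearMap)ᗮ :=
  Submodule.starProjection_apply_mem _ z

theorem apply_coimageProj (T : X →L[ℝ] X) (z : X) : T (coimageProj T z) = T z := by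
  have h : z - coimageProj T z ∈ (LinearMap.ker T.toLinearMap)ᗮᗮ :=
    Submodule.sub_starProjection_mem_orthogonal z
  rw [Submodule.orthogonal_orthogonal] at h
  have h2 : T (z - coimageProj T z) = 0 := h
  rw [map_sub, sub_eq_zero] at h2
  exact h2.symm

theorem norm_coimageProj_le (T : X →L[ℝ] X) (z : X) : ‖coimageProj T z‖ ≤ ‖z‖ :=
  Submodule.norm_starProjection_apply_le _ z

/-- The range of a symmetric operator is orthogonal to its kernel. Hence the projection fixes all
gradients of the dual objective. -/
theorem coimageProj_apply {T : X →L[ℝ] X} (hT : ∀ x y, ⟪T x, y⟫ = ⟪x, T y⟫) (z : X) :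
    coimageProj T (T z) = T z := by
  refine Submodule.starProjection_eq_self_iff.2 fun u hu => ?_
  rw [← hT, show T u = 0 from hu, inner_zero_left]

end Coimage

/-! ### Duality on the kernel of a symmetric operator, and primal recovery -/

section DualProblem

variable {X : Type} [NormedAddCommGroup X] [InnerProductSpace ℝ X] [FiniteDimensional ℝ X]

theorem exists_apply_eq_of_orthogonal_ker {T : X →L[ℝ] X} (hT : ∀ x y, ⟪T x, y⟫ = ⟪x, T y⟫) {w : X}
    (hw : ∀ u, T u = 0 → ⟪w, u⟫ = 0) : ∃ z, T z = w := by
  have h1 : (LinearMap.range T.toLinearMap)ᗮ = LinearMap.ker T.toLinearMap :=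
    LinearMap.IsSymmetric.orthogonal_range (T := T.toLinearMap) hT
  have h2 : w ∈ (LinearMap.range T.toLinearMap)ᗮᗮ := by
    rw [h1]
    intro u hu
    rw [real_inner_comm]
    exact hw u hu
  rw [Submodule.orthogonal_orthogonal] at h2
  exact h2

variable [CompleteSpace X]

/-- A strongly convex function attains its minimum on the kernel of a symmetric operator, and its
gradient there lies in the range of the operator. -/
theorem StronglyConvexWith.exists_gradient_mem_range {c : ℝ} {g : X → ℝ}
    (hg : StronglyConvexWith c g) (hc : 0 < c) {T : X →L[ℝ] X}
    (hT : ∀ x y, ⟪T x, y⟫ = ⟪x, T y⟫) : ∃ z t, T t = 0 ∧ gradient g t = T z := by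
  let K : Submodule ℝ X := LinearMap.ker T.toLinearMap
  have hK : IsClosed (K : Set X) := K.closed_of_finiteDimensional
  have hcoc : Filter.Tendsto (fun k : K => g k) (Filter.cocompact K) Filter.atTop :=
    (hg.tendsto_cocompact hc).comp hK.isClosedEmbedding_subtypeVal.tendsto_cocompact
  obtain ⟨t, ht⟩ := (hg.1.continuous.comp continuous_subtype_val).exists_forall_le hcoc
  have hmin : IsLocalMin (fun k : K => g (K.subtypeL k)) t := Filter.Eventually.of_forall ht
  have hd : HasFDerivAt (fun k : K => g (K.subtypeL k))
      ((InnerProductSpace.toDual ℝ X (gradient g t)).comp K.subtypeL) t :=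
    (hasGradientAt_iff_hasFDerivAt.1 (hg.1 (K.subtypeL t)).hasGradientAt).comp t
      K.subtypeL.hasFDerivAt
  -- The derivative along ker T vanishes, so the gradient is orthogonal to ker T and lies in the
  -- range of T.
  have h0 := hmin.hasFDerivAt_eq_zero hd
  obtain ⟨z, hz⟩ := exists_apply_eq_of_orthogonal_ker hT (w := gradient g t) fun u hu => by
    have := congrArg (fun l => l (⟨u, hu⟩ : K)) h0
    simpa using this
  exact ⟨z, t, t.2, hz.symm⟩

/-- Weak duality: ⟨Tz, t⟩ = ⟨z, Tt⟩ = 0 for feasible t. -/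
theorem StronglyConvexWith.neg_le_conjugate {c : ℝ} {g : X → ℝ}
    (hg : StronglyConvexWith c g) (hc : 0 < c) {T : X →L[ℝ] X}
    (hT : ∀ x y, ⟪T x, y⟫ = ⟪x, T y⟫) (z : X) {t : X} (ht : T t = 0) :
    -g t ≤ conjugate g (T z) := by
  have h := (hg.isLUB_conjugate hc (T z)).1 ⟨t, rfl⟩
  simp only [hT, ht, inner_zero_right, zero_sub] at h
  exact h

/-- Strong duality for `min g` on the kernel of a symmetric operator `T`. -/
theorem StronglyConvexWith.exists_dual_minimizer {c : ℝ} {g : X → ℝ}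
    (hg : StronglyConvexWith c g) (hc : 0 < c) {T : X →L[ℝ] X}
    (hT : ∀ x y, ⟪T x, y⟫ = ⟪x, T y⟫) :
    ∃ z t, T t = 0 ∧ conjugate g (T z) = -g t ∧ ∀ z', conjugate g (T z) ≤ conjugate g (T z') := by
  obtain ⟨z, t, ht, hz⟩ := hg.exists_gradient_mem_range hc hT
  have h1 : conjugate g (T z) = -g t := by
    rw [← hz, hg.conjugate_gradient hc, hz, hT, ht, inner_zero_right, zero_sub]
  refine ⟨z, t, ht, h1, fun z' => ?_⟩
  rw [h1]
  exact hg.neg_le_conjugate hc hT z' ht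

theorem dual_smooth {c Λ : ℝ} {g : X → ℝ} (hg : StronglyConvexWith c g) (hc : 0 < c)
    {T : X →L[ℝ] X} (hT : ∀ x y, ⟪T x, y⟫ = ⟪x, T y⟫) (hΛ : ∀ z, ‖T z‖ ≤ Λ * ‖z‖) (y x : X) :
    conjugate g (T x) ≤ conjugate g (T y) + ⟪T (gradient (conjugate g) (T y)), x - y⟫ +
      Λ ^ 2 / c / 2 * ‖x - y‖ ^ 2 := by
  have h := (hg.smoothWith_conjugate hc).2 (T y) (T x)
  rw [← map_sub, ← hT] at h
  have h2 : ‖T (x - y)‖ ^ 2 ≤ Λ ^ 2 * ‖x - y‖ ^ 2 := by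
    rw [← mul_pow]
    exact pow_le_pow_left₀ (norm_nonneg _) (hΛ _) 2
  have h3 : 1 / c / 2 * ‖T (x - y)‖ ^ 2 ≤ Λ ^ 2 / c / 2 * ‖x - y‖ ^ 2 := by
    calc 1 / c / 2 * ‖T (x - y)‖ ^ 2 ≤ 1 / c / 2 * (Λ ^ 2 * ‖x - y‖ ^ 2) := by gcongr
      _ = _ := by ring
  linarith

theorem dual_descent {c Λ : ℝ} {g : X → ℝ} (hg : StronglyConvexWith c g) (hc : 0 < c)
    {T : X →L[ℝ] X} (hT : ∀ x y, ⟪T x, y⟫ = ⟪x, T y⟫) (hΛ0 : 0 < Λ) (hΛ : ∀ z, ‖T z‖ ≤ Λ * ‖z‖)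
    (y : X) :
    conjugate g (T (y - (Λ ^ 2 / c)⁻¹ • T (gradient (conjugate g) (T y)))) ≤ conjugate g (T y) -
      1 / (2 * (Λ ^ 2 / c)) * ‖T (gradient (conjugate g) (T y))‖ ^ 2 := by
  set G := T (gradient (conjugate g) (T y))
  refine (dual_smooth hg hc hT hΛ y _).trans (le_of_eq ?_)
  rw [sub_sub_cancel_left, inner_neg_right, inner_smul_right, norm_neg, norm_smul, mul_pow,
    Real.norm_eq_abs, sq_abs, real_inner_self_eq_norm_sq]
  field_simp
  ring

/-- Along ker T the dual objective is constant, so strong convexity can only be measured after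
projection, where T is bounded below by l. The linear term may be projected too, since T moves to
the other factor and does not see the kernel component. -/
theorem dual_stronglyConvex {c L l : ℝ} {g : X → ℝ} (hg : StronglyConvexWith c g) (hc : 0 < c)
    (hs : SmoothWith L g) (hL : 0 < L) {T : X →L[ℝ] X} (hT : ∀ x y, ⟪T x, y⟫ = ⟪x, T y⟫)
    (hl0 : 0 ≤ l) (hl : ∀ z ∈ (LinearMap.ker T.toLinearMap)ᗮ, l * ‖z‖ ≤ ‖T z‖) (x y : X) :
    conjugate g (T y) + ⟪T (gradient (conjugate g) (T y)), coimageProj T (x - y)⟫ +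
      l ^ 2 / L / 2 * ‖coimageProj T (x - y)‖ ^ 2 ≤ conjugate g (T x) := by
  have h := (hs.stronglyConvexWith_conjugate hL hg hc).2 (T y) (T x)
  rw [← map_sub] at h
  rw [hT, apply_coimageProj]
  have h2 : l ^ 2 * ‖coimageProj T (x - y)‖ ^ 2 ≤ ‖T (x - y)‖ ^ 2 := by
    rw [← mul_pow, ← apply_coimageProj T (x - y)]
    exact pow_le_pow_left₀ (by positivity) (hl _ (coimageProj_mem T _)) 2
  have h3 : l ^ 2 / L / 2 * ‖coimageProj T (x - y)‖ ^ 2 ≤ 1 / L / 2 * ‖T (x - y)‖ ^ 2 := by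
    calc _ = 1 / L / 2 * (l ^ 2 * ‖coimageProj T (x - y)‖ ^ 2) := by ring
      _ ≤ _ := by gcongr
  linarith

theorem gradient_dual_eq_zero {c : ℝ} {g : X → ℝ} (hg : StronglyConvexWith c g) (hc : 0 < c)
    {T : X →L[ℝ] X} (hT : ∀ x y, ⟪T x, y⟫ = ⟪x, T y⟫) {zs : X}
    (hzs : ∀ z, conjugate g (T zs) ≤ conjugate g (T z)) :
    T (gradient (conjugate g) (T zs)) = 0 := by
  have h := HasGradientAt.comp_symmetric hT
    (hg.differentiable_conjugate hc (T zs)).hasGradientAt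
  rw [← h.gradient]
  exact gradient_eq_zero_of_isLocalMin (Filter.Eventually.of_forall hzs)

/-- Accuracy of the primal point after `N` steps of the fast gradient method for the dual of
`min g` on the kernel of `T`. -/
theorem fastGradientIter_dual {c L Λ l s R : ℝ} {g : X → ℝ} (hg : StronglyConvexWith c g)
    (hc : 0 < c) (hsm : SmoothWith L g) (hcL : c ≤ L) {T : X →L[ℝ] X}
    (hT : ∀ x y, ⟪T x, y⟫ = ⟪x, T y⟫) (hl0 : 0 < l) (hlΛ : l ≤ Λ) (hΛ : ∀ z, ‖T z‖ ≤ Λ * ‖z‖)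
    (hl : ∀ z ∈ (LinearMap.ker T.toLinearMap)ᗮ, l * ‖z‖ ≤ ‖T z‖) (hs : s = √(L / c) * (Λ / l))
    {z₀ zs : X} (hzs : ∀ z, conjugate g (T zs) ≤ conjugate g (T z)) (hR : ‖zs‖ ≤ R)
    (hR' : ‖z₀ - zs‖ ≤ R) (N : ℕ) {t : X}
    (ht : t = gradient (conjugate g) (T (fastGradientIter
      (fun z => T (gradient (conjugate g) (T z))) (c / Λ ^ 2) ((s - 1) / (s + 1)) N z₀ z₀))) :
    g t + conjugate g (T zs) ≤ 4 * (s * (Λ ^ 2 / c) * R ^ 2) * Real.exp (-(N / (2 * s))) ∧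
      ‖T t‖ ≤ 2 * (Λ ^ 2 / c * R) * Real.exp (-(N / (2 * s))) := by
  have hL0 : 0 < L := hc.trans_le hcL
  have hΛ0 : 0 < Λ := hl0.trans_le hlΛ
  have hs1 : 1 ≤ s := by
    rw [hs]
    refine one_le_mul_of_one_le_of_one_le ?_ ((one_le_div hl0).2 hlΛ)
    rw [Real.one_le_sqrt, one_le_div hc]
    exact hcL
  have hs0 : 0 < s := by linarith
  have hR0 : 0 ≤ R := (norm_nonneg _).trans hR
  set M := Λ ^ 2 / c with hM
  have hM0 : 0 < M := by positivity
  have hη : c / Λ ^ 2 = M⁻¹ := by rw [hM, inv_div]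
  have hsq : s ^ 2 = L / c * (Λ / l) ^ 2 := by
    rw [hs, mul_pow, Real.sq_sqrt (by positivity)]
  -- s² is the condition number of the dual objective modulo ker T.
  have hk : l ^ 2 / L = M / s ^ 2 := by
    rw [hsq, hM]
    field_simp
  set κ := l ^ 2 / L with hκ
  have hκ0 : 0 < κ := by positivity
  have hκM : κ ≤ M := by
    rw [hk]
    exact div_le_self hM0.le (one_le_pow₀ hs1)
  have hdesc := dual_descent hg hc hT hΛ0 hΛ
  have hconv := dual_stronglyConvex hg hc hsm hL0 hT hl0.le hl
  set Ψ : X → ℝ := fun z => conjugate g (T z) with hΨ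
  set G : X → X := fun z => T (gradient (conjugate g) (T z)) with hG
  have hG0 : G zs = 0 := gradient_dual_eq_zero hg hc hT hzs
  have hGp : ∀ y, coimageProj T (G y) = G y := fun y => coimageProj_apply hT _
  have hfg := fastGradientIter_le (Ψ := Ψ) (grad := G) (Q := coimageProj T) hs1 hM0 hk hdesc hconv
    hGp zs N z₀ z₀
  rw [← hη] at hfg
  set z := fastGradientIter G (c / Λ ^ 2) ((s - 1) / (s + 1)) N z₀ z₀ with hz
  -- Half the rate of the dual gap: (1 - 1/s)^N ≤ e², and the primal errors are of the order of the
  -- square root of the gap.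
  set e := Real.exp (-(N / (2 * s))) with he
  have he0 : 0 < e := Real.exp_pos _
  have he1 : e ≤ 1 := Real.exp_le_one_iff.2 (by
    rw [neg_nonpos]
    positivity)
  have hpow : (1 - 1 / s) ^ N ≤ e ^ 2 := by
    have h1 : 1 - 1 / s ≤ Real.exp (-(1 / s)) := by
      have := Real.add_one_le_exp (-(1 / s))
      linarith
    have h2 : 0 ≤ 1 - 1 / s := by
      rw [sub_nonneg, div_le_one hs0]
      exact hs1
    refine (pow_le_pow_left₀ h2 h1 N).trans (le_of_eq ?_)
    rw [he, ← Real.exp_nat_mul, ← Real.exp_nat_mul]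
    congr 1
    field_simp
    push_cast
    ring
  -- Equal starting iterates make the auxiliary point z₀ itself. The gap and the distance term each
  -- contribute at most MR²/2.
  have hV0 : Ψ z₀ - Ψ zs + κ / 2 * ‖coimageProj T (z₀ + s • (z₀ - z₀) - zs)‖ ^ 2 ≤ M * R ^ 2 := by
    have h1 := dual_smooth hg hc hT hΛ zs z₀
    rw [show T (gradient (conjugate g) (T zs)) = 0 from hG0, inner_zero_left] at h1
    have h2 : ‖z₀ - zs‖ ^ 2 ≤ R ^ 2 := pow_le_pow_left₀ (norm_nonneg _) hR' 2
    have h3 : ‖coimageProj T (z₀ + s • (z₀ - z₀) - zs)‖ ^ 2 ≤ R ^ 2 := by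
      rw [sub_self, smul_zero, add_zero]
      exact pow_le_pow_left₀ (norm_nonneg _) ((norm_coimageProj_le T _).trans hR') 2
    have h4 : M / 2 * ‖z₀ - zs‖ ^ 2 ≤ M / 2 * R ^ 2 := by gcongr
    have h5 : κ / 2 * ‖coimageProj T (z₀ + s • (z₀ - z₀) - zs)‖ ^ 2 ≤ M / 2 * R ^ 2 := by gcongr
    simp only [hΨ]
    linarith
  have hD : Ψ z - Ψ zs ≤ e ^ 2 * (M * R ^ 2) := by
    refine hfg.trans ?_
    have : 0 ≤ Ψ z₀ - Ψ zs + κ / 2 * ‖coimageProj T (z₀ + s • (z₀ - z₀) - zs)‖ ^ 2 :=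
      add_nonneg (sub_nonneg.2 (hzs z₀)) (by positivity)
    exact mul_le_mul hpow hV0 this (by positivity)
  -- A gradient step from z cannot go below the minimum, so ‖G z‖² is at most 2M times the gap; 3/2
  -- replaces √2.
  have hGn : ‖G z‖ ≤ 3 / 2 * (M * R * e) := by
    have h1 := (hzs _).trans (hdesc z)
    have h2 : 1 / (2 * M) * ‖G z‖ ^ 2 ≤ e ^ 2 * (M * R ^ 2) := by
      simp only [hΨ] at hD
      linarith
    have h3 : ‖G z‖ ^ 2 ≤ 2 * M * (e ^ 2 * (M * R ^ 2)) := by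
      rw [one_div, inv_mul_le_iff₀ (by positivity)] at h2
      exact h2
    refine abs_le_of_sq_le_sq' (h3.trans ?_) (by positivity) |>.2
    linarith [sq_nonneg (M * R * e)]
  have hPn : ‖coimageProj T (z - zs)‖ ≤ 3 / 2 * (e * s * R) := by
    have h1 := hconv z zs
    rw [show T (gradient (conjugate g) (T zs)) = 0 from hG0, inner_zero_left] at h1
    change Ψ zs + 0 + κ / 2 * _ ≤ Ψ z at h1
    have h2 : κ / 2 * ‖coimageProj T (z - zs)‖ ^ 2 ≤ e ^ 2 * (M * R ^ 2) := by linarith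
    have h3 : ‖coimageProj T (z - zs)‖ ^ 2 ≤ 2 * (e * s * R) ^ 2 := by
      have h4 : M = κ * s ^ 2 := by rw [hk]; field_simp
      rw [h4] at h2
      have h5 : κ / 2 * ‖coimageProj T (z - zs)‖ ^ 2 ≤ κ / 2 * (2 * (e * s * R) ^ 2) := by
        refine h2.trans (le_of_eq ?_)
        ring
      exact le_of_mul_le_mul_left h5 (by positivity)
    refine abs_le_of_sq_le_sq' (h3.trans ?_) (by positivity) |>.2
    linarith [sq_nonneg (e * s * R)]
  have hTt : T t = G z := by rw [ht]
  refine ⟨?_, ?_⟩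
  · have hgt : g t = ⟪z, G z⟫ - Ψ z := by
      have h1 := hg.conjugate_gradient hc t
      rw [show gradient g t = T z from by rw [ht, hg.gradient_gradient_conjugate hc]] at h1
      rw [hT, hTt] at h1
      simp only [hΨ]
      linarith
    -- Only the projection of z is controlled by the convergence estimate. Its norm is at most (1 +
    -- 3/2)sR, and 5/2 · 3/2 ≤ 4 gives the final constant.
    have h2 : ⟪z, G z⟫ = ⟪coimageProj T z, G z⟫ := by
      rw [← hTt, ← hT, ← hT, apply_coimageProj]
    have h3 : ‖coimageProj T z‖ ≤ 5 / 2 * (s * R) := by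
      have h4 : coimageProj T z = coimageProj T zs + coimageProj T (z - zs) := by
        rw [← map_add]
        congr 1
        abel
      rw [h4]
      refine (norm_add_le _ _).trans ?_
      have h5 : e * s * R ≤ 1 * s * R := by gcongr
      have h6 : 1 * R ≤ s * R := by gcongr
      have := (norm_coimageProj_le T zs).trans hR
      linarith
    have h4 : ⟪z, G z⟫ ≤ 5 / 2 * (s * R) * (3 / 2 * (M * R * e)) := by
      rw [h2]
      exact (real_inner_le_norm _ _).trans
        (mul_le_mul h3 hGn (norm_nonneg _) (by positivity))
    have h5 : 0 ≤ s * M * R ^ 2 * e := by positivity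
    have h6 := hzs z
    change g t + Ψ zs ≤ _
    have h7 : Ψ zs ≤ Ψ z := h6
    rw [hgt]
    linarith
  · rw [hTt]
    refine hGn.trans ?_
    have : 0 ≤ M * R * e := by positivity
    linarith

end DualProblem

/-! ### Kronecker actions on stacked vectors and the parametrization of ker B -/

section Stacks

variable {m n k d p r : ℕ}

theorem kronAct_apply (M : Matrix (Fin m) (Fin m) ℝ) (z : Stack m n) (i : Fin m) :
    kronAct M z i = ∑ j, M i j • z j := rfl

theorem kronAct_apply_apply (M : Matrix (Fin m) (Fin m) ℝ) (z : Stack m n) (i : Fin m)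
    (c : Fin n) : kronAct M z i c = M.mulVec (fun j => z j c) i := by
  simp [kronAct_apply, Matrix.mulVec, dotProduct]

theorem blockAct_apply (D : Matrix (Fin k) (Fin n) ℝ) (z : Stack m n) (i : Fin m) :
    blockAct D z i = Matrix.toEuclideanLin D (z i) := rfl

theorem stack_ext {x y : Stack m n} (h : ∀ i c, x i c = y i c) : x = y :=
  PiLp.ext fun i => PiLp.ext (h i)

theorem kronAct_eq_zero_iff (M : Matrix (Fin m) (Fin m) ℝ) (z : Stack m n) :
    kronAct M z = 0 ↔ ∀ c, M.mulVec (fun i => z i c) = 0 := by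
  constructor
  · intro h c
    ext i
    rw [← kronAct_apply_apply, h]
    rfl
  · intro h
    refine stack_ext fun i c => ?_
    rw [kronAct_apply_apply, h]
    rfl

theorem kronAct_one (z : Stack m n) : kronAct (1 : Matrix (Fin m) (Fin m) ℝ) z = z := by
  refine stack_ext fun i c => ?_
  rw [kronAct_apply_apply, Matrix.one_mulVec]

theorem kronAct_add_left (M M' : Matrix (Fin m) (Fin m) ℝ) (z : Stack m n) :
    kronAct (M + M') z = kronAct M z + kronAct M' z := by
  refine stack_ext fun i c => ?_
  simp only [PiLp.add_apply, kronAct_apply_apply, Matrix.add_mulVec, Pi.add_apply]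

theorem kronAct_smul_left (a : ℝ) (M : Matrix (Fin m) (Fin m) ℝ) (z : Stack m n) :
    kronAct (a • M) z = a • kronAct M z := by
  refine stack_ext fun i c => ?_
  simp only [PiLp.smul_apply, kronAct_apply_apply, Matrix.smul_mulVec, Pi.smul_apply]

theorem kronAct_mul (M M' : Matrix (Fin m) (Fin m) ℝ) (z : Stack m n) :
    kronAct (M * M') z = kronAct M (kronAct M' z) := by
  refine stack_ext fun i c => ?_
  rw [kronAct_apply_apply, kronAct_apply_apply, ← Matrix.mulVec_mulVec]
  congr 1
  ext j
  rw [kronAct_apply_apply]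

theorem kronAct_add (M : Matrix (Fin m) (Fin m) ℝ) (x y : Stack m n) :
    kronAct M (x + y) = kronAct M x + kronAct M y := by
  refine PiLp.ext fun i => ?_
  simp only [PiLp.add_apply, kronAct_apply, smul_add, Finset.sum_add_distrib]

theorem kronAct_smul (M : Matrix (Fin m) (Fin m) ℝ) (a : ℝ) (x : Stack m n) :
    kronAct M (a • x) = a • kronAct M x := by
  refine PiLp.ext fun i => ?_
  simp only [PiLp.smul_apply, kronAct_apply, Finset.smul_sum]
  exact Finset.sum_congr rfl fun j _ => smul_comm _ _ _

/-- The action of `M ⊗ I` as a continuous linear map. -/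
noncomputable def kronCLM (n : ℕ) (M : Matrix (Fin m) (Fin m) ℝ) : Stack m n →L[ℝ] Stack m n where
  toFun := kronAct M
  map_add' := kronAct_add M
  map_smul' := kronAct_smul M
  cont := by
    refine (PiLp.continuous_toLp 2 (fun _ : Fin m => Vec n)).comp (continuous_pi fun i => ?_)
    exact continuous_finsetSum _ fun j _ =>
      (PiLp.continuous_apply 2 (fun _ : Fin m => Vec n) j).const_smul (M i j)

theorem inner_kronAct {M : Matrix (Fin m) (Fin m) ℝ} (hM : M.IsHermitian) (x y : Stack m n) :
    ⟪kronAct M x, y⟫ = ⟪x, kronAct M y⟫ := by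
  simp only [PiLp.inner_apply (𝕜 := ℝ) (f := fun _ : Fin m => Vec n), kronAct_apply, sum_inner,
    inner_sum, real_inner_smul_left, real_inner_smul_right]
  rw [Finset.sum_comm]
  refine Finset.sum_congr rfl fun i _ => Finset.sum_congr rfl fun j _ => ?_
  rw [← hM.apply i j, star_trivial]

theorem toEuclideanLin_apply_apply (D : Matrix (Fin k) (Fin n) ℝ) (x : Vec n) (i : Fin k) :
    Matrix.toEuclideanLin D x i = D.mulVec (fun j => x j) i := rfl

theorem inner_toEuclideanLin (D : Matrix (Fin k) (Fin n) ℝ) (x : Vec n) (y : Vec k) :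
    ⟪y, Matrix.toEuclideanLin D x⟫ = ⟪Matrix.toEuclideanLin D.transpose y, x⟫ := by
  simp only [PiLp.inner_apply, toEuclideanLin_apply_apply, Matrix.mulVec, dotProduct,
    RCLike.inner_apply, conj_trivial, Matrix.transpose_apply, Finset.sum_mul, Finset.mul_sum]
  rw [Finset.sum_comm]
  refine Finset.sum_congr rfl fun i _ => Finset.sum_congr rfl fun j _ => ?_
  ring

theorem inner_blockAct (D : Matrix (Fin k) (Fin n) ℝ) (x : Stack m n) (y : Stack m k) :
    ⟪y, blockAct D x⟫ = ⟪blockAct D.transpose y, x⟫ := by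
  simp only [PiLp.inner_apply (𝕜 := ℝ) (f := fun _ : Fin m => Vec k),
    PiLp.inner_apply (𝕜 := ℝ) (f := fun _ : Fin m => Vec n), blockAct_apply,
    inner_toEuclideanLin]

theorem norm_toEuclideanLin {E : Matrix (Fin d) (Fin r) ℝ} (hE : E.transpose * E = 1)
    (t : Vec r) : ‖Matrix.toEuclideanLin E t‖ = ‖t‖ := by
  have h : Matrix.toEuclideanLin E.transpose (Matrix.toEuclideanLin E t) = t := by
    refine PiLp.ext fun i => ?_
    rw [toEuclideanLin_apply_apply]
    change E.transpose.mulVec (E.mulVec t) i = _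
    rw [Matrix.mulVec_mulVec, hE, Matrix.one_mulVec]
  rw [← sq_eq_sq₀ (norm_nonneg _) (norm_nonneg _), ← real_inner_self_eq_norm_sq,
    ← real_inner_self_eq_norm_sq, inner_toEuclideanLin, h]

theorem norm_sq_stack (z : Stack m n) : ‖z‖ ^ 2 = ∑ i, ‖z i‖ ^ 2 := PiLp.norm_sq_eq_of_L2 _ z

theorem norm_blockAct {E : Matrix (Fin d) (Fin r) ℝ} (hE : E.transpose * E = 1)
    (t : Stack m r) : ‖blockAct E t‖ = ‖t‖ := by
  rw [← sq_eq_sq₀ (norm_nonneg _) (norm_nonneg _), norm_sq_stack, norm_sq_stack]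
  simp only [blockAct_apply, norm_toEuclideanLin hE]

theorem kronAct_blockAct (M : Matrix (Fin m) (Fin m) ℝ) (E : Matrix (Fin d) (Fin r) ℝ)
    (t : Stack m r) : kronAct M (blockAct E t) = blockAct E (kronAct M t) := by
  refine PiLp.ext fun i => ?_
  simp only [kronAct_apply, blockAct_apply, map_sum, map_smul]

theorem blockAct_injective {E : Matrix (Fin d) (Fin r) ℝ} (hE : E.transpose * E = 1) {t : Stack m r}
    (h : blockAct E t = 0) : t = 0 := by
  rw [← norm_eq_zero, ← norm_blockAct hE, h, norm_zero]

theorem blockAct_eq_zero_iff {B : Matrix (Fin p) (Fin d) ℝ} {E : Matrix (Fin d) (Fin r) ℝ}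
    (hE : IsKernelBasis B E) (x : Stack m d) :
    blockAct B x = 0 ↔ ∃ t : Stack m r, blockAct E t = x := by
  constructor
  · intro h
    have h1 : ∀ i, ∃ t, E.mulVec t = fun j => x i j := fun i => by
      refine (hE.range_eq _).1 ?_
      ext c
      rw [← toEuclideanLin_apply_apply, ← blockAct_apply, h]
      rfl
    choose t ht using h1
    refine ⟨WithLp.toLp 2 fun i => WithLp.toLp 2 (t i), stack_ext fun i c => ?_⟩
    rw [blockAct_apply, toEuclideanLin_apply_apply]
    exact congrFun (ht i) c
  · rintro ⟨t, rfl⟩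
    refine stack_ext fun i c => ?_
    exact congrFun ((hE.range_eq _).2 ⟨fun j => t i j, rfl⟩) c

/-- W⊗I commutes with I⊗E, and I⊗E is injective, so the consensus constraint passes to t unchanged.
-/
theorem mem_feasible_iff {B : Matrix (Fin p) (Fin d) ℝ} {E : Matrix (Fin d) (Fin r) ℝ}
    (hE : IsKernelBasis B E) (W : Matrix (Fin m) (Fin m) ℝ) (x : Stack m d) :
    x ∈ feasible B W ↔ ∃ t : Stack m r, kronAct W t = 0 ∧ blockAct E t = x := by
  have hz : blockAct E (0 : Stack m r) = 0 := PiLp.ext fun i => by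
    rw [blockAct_apply]
    exact map_zero _
  constructor
  · rintro ⟨h1, h2⟩
    obtain ⟨t, rfl⟩ := (blockAct_eq_zero_iff hE x).1 h2
    rw [kronAct_blockAct] at h1
    exact ⟨t, blockAct_injective hE.orthonormal h1, rfl⟩
  · rintro ⟨t, h1, rfl⟩
    refine ⟨?_, (blockAct_eq_zero_iff hE _).2 ⟨t, rfl⟩⟩
    rw [kronAct_blockAct, h1, hz]

theorem rank_add_of_isKernelBasis {B : Matrix (Fin p) (Fin d) ℝ} {E : Matrix (Fin d) (Fin r) ℝ}
    (hE : IsKernelBasis B E) : r + B.rank = d := by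
  have h1 : LinearMap.ker B.mulVecLin = LinearMap.range E.mulVecLin := by
    ext x
    exact hE.range_eq x
  have h2 : Function.Injective E.mulVecLin := by
    intro s t hst
    have := congrArg (fun v => E.transpose.mulVec v) hst
    simpa [Matrix.mulVec_mulVec, hE.orthonormal] using this
  have h3 := LinearMap.finrank_range_add_finrank_ker B.mulVecLin
  rw [h1, LinearMap.finrank_range_of_inj h2] at h3
  simp only [Module.finrank_fin_fun] at h3
  rw [Matrix.rank]
  omega

end Stacks

/-! ### Separable sums and the reparametrized objectives -/

section Separable

variable {m n d r : ℕ}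

theorem hasGradientAt_sepSum {g : Fin m → Vec n → ℝ} (hg : ∀ i, Differentiable ℝ (g i))
    (x : Stack m n) :
    HasGradientAt (sepSum g) (WithLp.toLp 2 fun i => gradient (g i) (x i)) x := by
  rw [hasGradientAt_iff_hasFDerivAt]
  have h : HasFDerivAt (fun x : Stack m n => ∑ i, g i (x i)) (∑ i, (InnerProductSpace.toDual ℝ
      (Vec n) (gradient (g i) (x i))).comp (PiLp.proj 2 (fun _ : Fin m => Vec n) i)) x :=
    HasFDerivAt.fun_sum fun i _ => (hasGradientAt_iff_hasFDerivAt.1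
      (hg i (x i)).hasGradientAt).comp x
        (PiLp.proj (𝕜 := ℝ) 2 (fun _ : Fin m => Vec n) i).hasFDerivAt
  refine h.congr_fderiv ?_
  ext y
  simp [PiLp.inner_apply (𝕜 := ℝ) (f := fun _ : Fin m => Vec n)]

theorem inner_gradient_sepSum {g : Fin m → Vec n → ℝ} (hg : ∀ i, Differentiable ℝ (g i))
    (x y : Stack m n) :
    ⟪gradient (sepSum g) x, y⟫ = ∑ i, ⟪gradient (g i) (x i), y i⟫ := by
  rw [(hasGradientAt_sepSum hg x).gradient,
    PiLp.inner_apply (𝕜 := ℝ) (f := fun _ : Fin m => Vec n)]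

theorem stronglyConvexWith_sepSum {c : ℝ} {g : Fin m → Vec n → ℝ}
    (hg : ∀ i, StronglyConvexWith c (g i)) : StronglyConvexWith c (sepSum g) := by
  have hd : ∀ i, Differentiable ℝ (g i) := fun i => (hg i).1
  refine ⟨fun x => (hasGradientAt_sepSum hd x).differentiableAt, fun x y => ?_⟩
  rw [inner_gradient_sepSum hd, norm_sq_stack, Finset.mul_sum]
  simp only [sepSum, ← Finset.sum_add_distrib]
  exact Finset.sum_le_sum fun i _ => (hg i).2 (x i) (y i)

theorem smoothWith_sepSum {c : ℝ} {g : Fin m → Vec n → ℝ}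
    (hg : ∀ i, SmoothWith c (g i)) : SmoothWith c (sepSum g) := by
  have hd : ∀ i, Differentiable ℝ (g i) := fun i => (hg i).1
  refine ⟨fun x => (hasGradientAt_sepSum hd x).differentiableAt, fun x y => ?_⟩
  rw [inner_gradient_sepSum hd, norm_sq_stack, Finset.mul_sum]
  simp only [sepSum, ← Finset.sum_add_distrib]
  exact Finset.sum_le_sum fun i _ => (hg i).2 (x i) (y i)

/-- The blockwise inverse of ∇H is ∇H*. One local oracle call at every node therefore evaluates the
gradient of the global conjugate. -/
theorem gradient_conjugate_sepSum {c : ℝ} {g : Fin m → Vec n → ℝ}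
    (hg : ∀ i, StronglyConvexWith c (g i)) (hc : 0 < c) (z : Stack m n) :
    gradient (conjugate (sepSum g)) z =
      WithLp.toLp 2 fun i => gradient (conjugate (g i)) (z i) := by
  set t : Stack m n := WithLp.toLp 2 fun i => gradient (conjugate (g i)) (z i) with ht
  have h : gradient (sepSum g) t = z := by
    rw [(hasGradientAt_sepSum (fun i => (hg i).1) t).gradient]
    refine PiLp.ext fun i => ?_
    exact (hg i).gradient_gradient_conjugate hc (z i)
  rw [← (stronglyConvexWith_sepSum hg).gradient_conjugate hc t, h]

theorem hasGradientAt_reparam {f : Fin m → Vec d → ℝ} {i : Fin m} (hf : Differentiable ℝ (f i))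
    (E : Matrix (Fin d) (Fin r) ℝ) (t : Vec r) :
    HasGradientAt (reparam f E i)
      (Matrix.toEuclideanLin E.transpose (gradient (f i) (Matrix.toEuclideanLin E t))) t := by
  rw [hasGradientAt_iff_hasFDerivAt]
  have h := (hasGradientAt_iff_hasFDerivAt.1 (hf (Matrix.toEuclideanLin E t)).hasGradientAt).comp t
    (LinearMap.toContinuousLinearMap (Matrix.toEuclideanLin E)).hasFDerivAt
  refine h.congr_fderiv ?_
  ext y
  exact inner_toEuclideanLin E y _

theorem stronglyConvexWith_reparam {c : ℝ} {f : Fin m → Vec d → ℝ} {i : Fin m}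
    (hf : StronglyConvexWith c (f i)) {E : Matrix (Fin d) (Fin r) ℝ}
    (hE : E.transpose * E = 1) : StronglyConvexWith c (reparam f E i) := by
  refine ⟨fun t => (hasGradientAt_reparam hf.1 E t).differentiableAt, fun s t => ?_⟩
  rw [(hasGradientAt_reparam hf.1 E s).gradient, ← inner_toEuclideanLin, ← norm_toEuclideanLin hE,
    map_sub]
  exact hf.2 _ _

theorem smoothWith_reparam {c : ℝ} {f : Fin m → Vec d → ℝ} {i : Fin m}
    (hf : SmoothWith c (f i)) {E : Matrix (Fin d) (Fin r) ℝ}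
    (hE : E.transpose * E = 1) : SmoothWith c (reparam f E i) := by
  refine ⟨fun t => (hasGradientAt_reparam hf.1 E t).differentiableAt, fun s t => ?_⟩
  rw [(hasGradientAt_reparam hf.1 E s).gradient, ← inner_toEuclideanLin, ← norm_toEuclideanLin hE,
    map_sub]
  exact hf.2 _ _

theorem sepSum_blockAct (f : Fin m → Vec d → ℝ) (E : Matrix (Fin d) (Fin r) ℝ) (t : Stack m r) :
    sepSum f (blockAct E t) = sepSum (reparam f E) t := rfl

/-- The admissible constants form a closed set, being cut out by inequalities affine in c, and are
bounded by L because the space is nontrivial. -/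
theorem exists_isGreatest_stronglyConvexWith [NeZero m] [Nontrivial (Vec n)] {μ L : ℝ}
    {g : Fin m → Vec n → ℝ} (hg : ∀ i, StronglyConvexWith μ (g i))
    (hs : ∀ i, SmoothWith L (g i)) :
    ∃ c, IsGreatest {c | ∀ i, StronglyConvexWith c (g i)} c ∧ μ ≤ c := by
  have hb : BddAbove {c | ∀ i, StronglyConvexWith c (g i)} :=
    ⟨L, fun c hc => (hc 0).le_of_smoothWith (hs 0)⟩
  refine ⟨sSup {c | ∀ i, StronglyConvexWith c (g i)}, ⟨?_, fun c hc => le_csSup hb hc⟩,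
    le_csSup hb hg⟩
  refine IsClosed.csSup_mem ?_ ⟨μ, hg⟩ hb
  have : {c | ∀ i, StronglyConvexWith c (g i)} = ⋂ i, ⋂ x, ⋂ y,
      {c | g i x + ⟪gradient (g i) x, y - x⟫ + c / 2 * ‖y - x‖ ^ 2 ≤ g i y} := by
    ext c
    simp only [Set.mem_iInter, Set.mem_ofPred_eq]
    exact ⟨fun h i x y => (h i).2 x y, fun h i => ⟨(hg i).1, h i⟩⟩
  rw [this]
  refine isClosed_iInter fun i => isClosed_iInter fun x => isClosed_iInter fun y => ?_
  exact isClosed_le (by fun_prop) continuous_const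

theorem exists_isLeast_smoothWith [NeZero m] [Nontrivial (Vec n)] {μ L : ℝ}
    {g : Fin m → Vec n → ℝ} (hg : ∀ i, StronglyConvexWith μ (g i))
    (hs : ∀ i, SmoothWith L (g i)) :
    ∃ c, IsLeast {c | ∀ i, SmoothWith c (g i)} c ∧ c ≤ L := by
  have hb : BddBelow {c | ∀ i, SmoothWith c (g i)} :=
    ⟨μ, fun c hc => (hg 0).le_of_smoothWith (hc 0)⟩
  refine ⟨sInf {c | ∀ i, SmoothWith c (g i)}, ⟨?_, fun c hc => csInf_le hb hc⟩,
    csInf_le hb hs⟩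
  refine IsClosed.csInf_mem ?_ ⟨L, hs⟩ hb
  have : {c | ∀ i, SmoothWith c (g i)} = ⋂ i, ⋂ x, ⋂ y,
      {c | g i y ≤ g i x + ⟪gradient (g i) x, y - x⟫ + c / 2 * ‖y - x‖ ^ 2} := by
    ext c
    simp only [Set.mem_iInter, Set.mem_ofPred_eq]
    exact ⟨fun h i x y => (h i).2 x y, fun h i => ⟨(hs i).1, h i⟩⟩
  rw [this]
  refine isClosed_iInter fun i => isClosed_iInter fun x => isClosed_iInter fun y => ?_
  exact isClosed_le continuous_const (by fun_prop)

end Separable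

/-! ### Values and costs of the decentralized computation -/

section Algorithm

variable {m d r : ℕ}

theorem gossip_val {G : SimpleGraph (Fin m)} {W : Matrix (Fin m) (Fin m) ℝ} (hW : IsMixing G W)
    (z : Stack m r) : (gossip G W z).val = kronAct W z := by
  classical
  refine PiLp.ext fun i => ?_
  rw [kronAct_apply, ← Finset.add_sum_erase _ _ (Finset.mem_univ i)]
  change W i i • z i + ∑ j, (if G.Adj i j then W i j • z j else 0) = _
  congr 1
  rw [← Finset.add_sum_erase _ _ (Finset.mem_univ i), if_neg (G.irrefl), zero_add]
  refine Finset.sum_congr rfl fun j hj => ?_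
  split_ifs with h
  · rfl
  · rw [hW.compatible i j (Finset.ne_of_mem_erase hj).symm h, zero_smul]

/-- The loop invariant, for an arbitrary accumulator y. The initial accumulator `P.leadingCoeff • v`
supplies the top term of P(W)v. -/
theorem hornerLoop_val {G : SimpleGraph (Fin m)} {W : Matrix (Fin m) (Fin m) ℝ}
    (hW : IsMixing G W) (P : Polynomial ℝ) (v : Stack m r) (k : ℕ) (y : Stack m r) :
    (hornerLoop G W P v k y).val =
      kronAct (W ^ k) y + kronAct (∑ j ∈ Finset.range k, P.coeff j • W ^ j) v := by
  induction k generalizing y with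
  | zero =>
    have h : kronAct (0 : Matrix (Fin m) (Fin m) ℝ) v = 0 := stack_ext fun i c => by
      rw [kronAct_apply_apply, Matrix.zero_mulVec]
      rfl
    rw [pow_zero, kronAct_one, Finset.sum_range_zero, h, add_zero]
    rfl
  | succ k ih =>
    change (hornerLoop G W P v k ((gossip G W y).val + P.coeff k • v)).val = _
    rw [ih, gossip_val hW, pow_succ, kronAct_mul, Finset.sum_range_succ, kronAct_add_left,
      kronAct_smul_left, kronAct_add, kronAct_smul]
    abel

theorem hornerLoop_communications (G : SimpleGraph (Fin m)) (W : Matrix (Fin m) (Fin m) ℝ)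
    (P : Polynomial ℝ) (v : Stack m r) (k : ℕ) (y : Stack m r) :
    (hornerLoop G W P v k y).communications = k := by
  induction k generalizing y with
  | zero => rfl
  | succ k ih =>
    change 1 + (hornerLoop G W P v k ((gossip G W y).val + P.coeff k • v)).communications = _
    rw [ih, add_comm]

theorem hornerLoop_oracleCalls (G : SimpleGraph (Fin m)) (W : Matrix (Fin m) (Fin m) ℝ)
    (P : Polynomial ℝ) (v : Stack m r) (k : ℕ) (y : Stack m r) :
    (hornerLoop G W P v k y).oracleCalls = 0 := by
  induction k generalizing y with
  | zero => rfl
  | succ k ih =>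
    change 0 + (hornerLoop G W P v k ((gossip G W y).val + P.coeff k • v)).oracleCalls = _
    rw [ih]

theorem polyGossip_val {G : SimpleGraph (Fin m)} {W : Matrix (Fin m) (Fin m) ℝ}
    (hW : IsMixing G W) (P : Polynomial ℝ) (v : Stack m r) :
    (polyGossip G W P v).val = kronAct (Polynomial.aeval W P) v := by
  rw [polyGossip, hornerLoop_val hW, Polynomial.aeval_eq_sum_range, Finset.sum_range_succ,
    kronAct_add_left, kronAct_smul_left, kronAct_smul, add_comm]
  rfl

theorem polyGossip_communications (G : SimpleGraph (Fin m)) (W : Matrix (Fin m) (Fin m) ℝ)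
    (P : Polynomial ℝ) (v : Stack m r) : (polyGossip G W P v).communications = P.natDegree :=
  hornerLoop_communications _ _ _ _ _ _

theorem polyGossip_oracleCalls (G : SimpleGraph (Fin m)) (W : Matrix (Fin m) (Fin m) ℝ)
    (P : Polynomial ℝ) (v : Stack m r) : (polyGossip G W P v).oracleCalls = 0 :=
  hornerLoop_oracleCalls _ _ _ _ _ _

theorem dualGrad_val {G : SimpleGraph (Fin m)} {W : Matrix (Fin m) (Fin m) ℝ}
    (hW : IsMixing G W) (P : Polynomial ℝ) {c : ℝ} {h : Fin m → Vec r → ℝ}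
    (hh : ∀ i, StronglyConvexWith c (h i)) (hc : 0 < c) (z : Stack m r) :
    (dualGrad G W P h z).val = kronAct (Polynomial.aeval W P)
      (gradient (conjugate (sepSum h)) (kronAct (Polynomial.aeval W P) z)) := by
  change (polyGossip G W P (dualOracle h (polyGossip G W P z).val).val).val = _
  rw [polyGossip_val hW, polyGossip_val hW, gradient_conjugate_sepSum hh hc]
  rfl

theorem dualGrad_oracleCalls (G : SimpleGraph (Fin m)) (W : Matrix (Fin m) (Fin m) ℝ)
    (P : Polynomial ℝ) (h : Fin m → Vec r → ℝ) (z : Stack m r) :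
    (dualGrad G W P h z).oracleCalls = 1 := by
  change (polyGossip G W P z).oracleCalls + (1 + (polyGossip G W P _).oracleCalls) = _
  rw [polyGossip_oracleCalls, polyGossip_oracleCalls]

theorem dualGrad_communications (G : SimpleGraph (Fin m)) (W : Matrix (Fin m) (Fin m) ℝ)
    (P : Polynomial ℝ) (h : Fin m → Vec r → ℝ) (z : Stack m r) :
    (dualGrad G W P h z).communications = 2 * P.natDegree := by
  change (polyGossip G W P z).communications + (0 + (polyGossip G W P _).communications) = _
  rw [polyGossip_communications, polyGossip_communications]
  ring

theorem fastGradientLoop_val (grad : Stack m r → Counted (Stack m r)) (η β : ℝ) (N : ℕ)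
    (w z : Stack m r) : (fastGradientLoop grad η β N w z).val =
      fastGradientIter (fun y => (grad y).val) η β N w z := by
  induction N generalizing w z with
  | zero => rfl
  | succ N ih => exact ih _ _

theorem fastGradientLoop_oracleCalls {grad : Stack m r → Counted (Stack m r)} {a : ℕ}
    (hg : ∀ z, (grad z).oracleCalls = a) (η β : ℝ) (N : ℕ) (w z : Stack m r) :
    (fastGradientLoop grad η β N w z).oracleCalls = N * a := by
  induction N generalizing w z with
  | zero => exact (zero_mul a).symm
  | succ N ih =>
    change (grad _).oracleCalls + (fastGradientLoop grad η β N _ _).oracleCalls = _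
    rw [ih, hg]
    ring

theorem fastGradientLoop_communications {grad : Stack m r → Counted (Stack m r)} {a : ℕ}
    (hg : ∀ z, (grad z).communications = a) (η β : ℝ) (N : ℕ) (w z : Stack m r) :
    (fastGradientLoop grad η β N w z).communications = N * a := by
  induction N generalizing w z with
  | zero => exact (zero_mul a).symm
  | succ N ih =>
    change (grad _).communications + (fastGradientLoop grad η β N _ _).communications = _
    rw [ih, hg]
    ring

theorem locallyDual_val {G : SimpleGraph (Fin m)} {W : Matrix (Fin m) (Fin m) ℝ}
    (hW : IsMixing G W) {P : Polynomial ℝ} {M : Matrix (Fin m) (Fin m) ℝ}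
    (hM : Polynomial.aeval W P = M) {f : Fin m → Vec d → ℝ}
    {E : Matrix (Fin d) (Fin r) ℝ} {μt : ℝ} (Lt : ℝ) (hμ : 0 < μt)
    (hh : ∀ i, StronglyConvexWith μt (reparam f E i)) (z₀ : Stack m r) (N : ℕ) :
    (locallyDual G W P f E μt Lt z₀ N).val =
      blockAct E (gradient (conjugate (sepSum (reparam f E))) (kronAct M (fastGradientIter
        (fun z => kronAct M (gradient (conjugate (sepSum (reparam f E))) (kronAct M z)))
        (μt / lamMax M ^ 2) ((√(Lt / μt) * chi M - 1) / (√(Lt / μt) * chi M + 1)) N z₀ z₀))) := by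
  subst hM
  change blockAct E (dualOracle (reparam f E) (polyGossip G W P
    (fastGradientLoop (dualGrad G W P (reparam f E)) _ _ N z₀ z₀).val).val).val = _
  rw [polyGossip_val hW, fastGradientLoop_val, gradient_conjugate_sepSum hh hμ]
  simp only [dualGrad_val hW P hh hμ]
  rfl

theorem locallyDual_oracleCalls (G : SimpleGraph (Fin m)) (W : Matrix (Fin m) (Fin m) ℝ)
    (P : Polynomial ℝ) (f : Fin m → Vec d → ℝ) (E : Matrix (Fin d) (Fin r) ℝ) (μt Lt : ℝ)
    (z₀ : Stack m r) (N : ℕ) : (locallyDual G W P f E μt Lt z₀ N).oracleCalls = N + 1 := by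
  change (fastGradientLoop (dualGrad G W P (reparam f E)) _ _ N z₀ z₀).oracleCalls +
    ((polyGossip G W P _).oracleCalls + (1 + 0)) = _
  rw [polyGossip_oracleCalls, fastGradientLoop_oracleCalls (dualGrad_oracleCalls G W P _)]
  ring

/-- Each step multiplies by P(W) twice; the output point needs one more multiplication. -/
theorem locallyDual_communications (G : SimpleGraph (Fin m)) (W : Matrix (Fin m) (Fin m) ℝ)
    (P : Polynomial ℝ) (f : Fin m → Vec d → ℝ) (E : Matrix (Fin d) (Fin r) ℝ) (μt Lt : ℝ)
    (z₀ : Stack m r) (N : ℕ) :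
    (locallyDual G W P f E μt Lt z₀ N).communications = (2 * N + 1) * P.natDegree := by
  change (fastGradientLoop (dualGrad G W P (reparam f E)) _ _ N z₀ z₀).communications +
    ((polyGossip G W P _).communications + (0 + 0)) = _
  rw [polyGossip_communications,
    fastGradientLoop_communications (dualGrad_communications G W P _)]
  ring

end Algorithm

/-! ### Eigenvalue bounds and polynomials of a symmetric matrix -/

section Spectrum

variable {m n : ℕ} {M : Matrix (Fin m) (Fin m) ℝ}

theorem le_lamMax {x : ℝ} (hx : x ∈ spectrum ℝ M) : x ≤ lamMax M :=
  le_csSup Matrix.finite_real_spectrum.bddAbove hx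

theorem lamMinPos_le {x : ℝ} (hx : x ∈ spectrum ℝ M) (h0 : x ≠ 0) : lamMinPos M ≤ x :=
  csInf_le (Matrix.finite_real_spectrum.subset Set.sdiff_subset).bddBelow ⟨hx, h0⟩

theorem spectrum_nonneg_of_posSemidef (hM : M.PosSemidef) {x : ℝ} (hx : x ∈ spectrum ℝ M) :
    0 ≤ x :=
  (Matrix.posSemidef_iff_isHermitian_and_spectrum_nonneg.1 hM).2 hx

theorem spectrum_diff_zero_nonempty (hM : M.IsHermitian) (h0 : M ≠ 0) :
    (spectrum ℝ M \ {0}).Nonempty := by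
  by_contra hne
  rw [Set.not_nonempty_iff_eq_empty, Set.sdiff_eq_empty] at hne
  refine h0 (hM.eigenvalues_eq_zero_iff.1 (funext fun i => ?_))
  exact hne (hM.eigenvalues_mem_spectrum_real i)

theorem lamMinPos_mem (hM : M.IsHermitian) (h0 : M ≠ 0) : lamMinPos M ∈ spectrum ℝ M \ {0} :=
  (spectrum_diff_zero_nonempty hM h0).csInf_mem
    (Matrix.finite_real_spectrum.subset Set.sdiff_subset)

theorem lamMinPos_pos (hM : M.PosSemidef) (h0 : M ≠ 0) : 0 < lamMinPos M := by
  have h := lamMinPos_mem hM.isHermitian h0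
  exact lt_of_le_of_ne (spectrum_nonneg_of_posSemidef hM h.1) (Ne.symm h.2)

theorem lamMinPos_le_lamMax (hM : M.IsHermitian) (h0 : M ≠ 0) : lamMinPos M ≤ lamMax M :=
  le_lamMax (lamMinPos_mem hM h0).1

theorem lamMax_mem (hM : M.IsHermitian) (h0 : M ≠ 0) : lamMax M ∈ spectrum ℝ M :=
  ((spectrum_diff_zero_nonempty hM h0).mono Set.sdiff_subset).csSup_mem
    Matrix.finite_real_spectrum

theorem one_le_chi (hM : M.PosSemidef) (h0 : M ≠ 0) : 1 ≤ chi M :=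
  (one_le_div (lamMinPos_pos hM h0)).2 (lamMinPos_le_lamMax hM.isHermitian h0)

theorem inner_toEuclideanLin_eigenvectorBasis (hM : M.IsHermitian) (i : Fin m) (v : Vec m) :
    ⟪hM.eigenvectorBasis i, Matrix.toEuclideanLin M v⟫ =
      hM.eigenvalues i * ⟪hM.eigenvectorBasis i, v⟫ := by
  have h : Matrix.toEuclideanLin M.transpose (hM.eigenvectorBasis i) =
      hM.eigenvalues i • hM.eigenvectorBasis i := by
    rw [← Matrix.conjTranspose_eq_transpose_of_trivial, hM.eq]
    exact PiLp.ext fun j => congrFun (hM.mulVec_eigenvectorBasis i) j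
  rw [inner_toEuclideanLin, h, real_inner_smul_left]

theorem norm_sq_eq_sum_eigenvectorBasis (hM : M.IsHermitian) (v : Vec m) :
    ‖v‖ ^ 2 = ∑ i, ⟪hM.eigenvectorBasis i, v⟫ ^ 2 := by
  rw [← hM.eigenvectorBasis.sum_sq_norm_inner_right]
  simp only [Real.norm_eq_abs, sq_abs]

theorem norm_sq_toEuclideanLin_le (hM : M.PosSemidef) (v : Vec m) :
    ‖Matrix.toEuclideanLin M v‖ ^ 2 ≤ lamMax M ^ 2 * ‖v‖ ^ 2 := by
  rw [norm_sq_eq_sum_eigenvectorBasis hM.isHermitian,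
    norm_sq_eq_sum_eigenvectorBasis hM.isHermitian v, Finset.mul_sum]
  refine Finset.sum_le_sum fun i _ => ?_
  rw [inner_toEuclideanLin_eigenvectorBasis, mul_pow]
  gcongr
  · exact hM.eigenvalues_nonneg i
  · exact le_lamMax (hM.isHermitian.eigenvalues_mem_spectrum_real i)

/-- In an eigenbasis, orthogonality to the kernel removes the coefficients at zero eigenvalues, and
every other eigenvalue is at least `lamMinPos M`. -/
theorem le_norm_sq_toEuclideanLin (hM : M.PosSemidef) (h0 : M ≠ 0) {v : Vec m}
    (hv : ∀ u : Vec m, Matrix.toEuclideanLin M u = 0 → ⟪u, v⟫ = 0) :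
    lamMinPos M ^ 2 * ‖v‖ ^ 2 ≤ ‖Matrix.toEuclideanLin M v‖ ^ 2 := by
  rw [norm_sq_eq_sum_eigenvectorBasis hM.isHermitian,
    norm_sq_eq_sum_eigenvectorBasis hM.isHermitian (Matrix.toEuclideanLin M v), Finset.mul_sum]
  refine Finset.sum_le_sum fun i _ => ?_
  rw [inner_toEuclideanLin_eigenvectorBasis, mul_pow]
  by_cases hi : hM.isHermitian.eigenvalues i = 0
  · rw [hv (hM.isHermitian.eigenvectorBasis i), zero_pow two_ne_zero, mul_zero, mul_zero]
    refine PiLp.ext fun j => ?_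
    refine (congrFun (hM.isHermitian.mulVec_eigenvectorBasis i) j).trans ?_
    rw [hi, zero_smul]
    rfl
  · have := (lamMinPos_pos hM h0).le
    gcongr
    exact lamMinPos_le (hM.isHermitian.eigenvalues_mem_spectrum_real i) hi

/-- The vector of the `c`-th coordinates of the blocks. -/
noncomputable def stackCol (z : Stack m n) (c : Fin n) : Vec m := WithLp.toLp 2 fun i => z i c

theorem norm_sq_eq_sum_stackCol (z : Stack m n) : ‖z‖ ^ 2 = ∑ c, ‖stackCol z c‖ ^ 2 := by
  rw [norm_sq_stack]
  simp only [EuclideanSpace.real_norm_sq_eq]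
  exact Finset.sum_comm

theorem stackCol_kronAct (M : Matrix (Fin m) (Fin m) ℝ) (z : Stack m n) (c : Fin n) :
    stackCol (kronAct M z) c = Matrix.toEuclideanLin M (stackCol z c) :=
  PiLp.ext fun i => kronAct_apply_apply M z i c

theorem norm_kronAct_le (hM : M.PosSemidef) (h0 : M ≠ 0) (z : Stack m n) :
    ‖kronAct M z‖ ≤ lamMax M * ‖z‖ := by
  have hΛ : 0 ≤ lamMax M := (lamMinPos_pos hM h0).le.trans (lamMinPos_le_lamMax hM.isHermitian h0)
  rw [← sq_le_sq₀ (norm_nonneg _) (by positivity), mul_pow, norm_sq_eq_sum_stackCol,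
    norm_sq_eq_sum_stackCol z, Finset.mul_sum]
  refine Finset.sum_le_sum fun c _ => ?_
  rw [stackCol_kronAct]
  exact norm_sq_toEuclideanLin_le hM _

theorem le_norm_kronAct (hM : M.PosSemidef) (h0 : M ≠ 0) {z : Stack m n}
    (hz : z ∈ (LinearMap.ker (kronCLM n M).toLinearMap)ᗮ) :
    lamMinPos M * ‖z‖ ≤ ‖kronAct M z‖ := by
  have hl := (lamMinPos_pos hM h0).le
  rw [← sq_le_sq₀ (by positivity) (norm_nonneg _), mul_pow, norm_sq_eq_sum_stackCol,
    norm_sq_eq_sum_stackCol (kronAct M z), Finset.mul_sum]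
  refine Finset.sum_le_sum fun c _ => ?_
  rw [stackCol_kronAct]
  refine le_norm_sq_toEuclideanLin hM h0 fun u hu => ?_
  -- A kernel vector of M placed in the c-th coordinates of the blocks is a kernel vector of M⊗I;
  -- this reduces orthogonality to one coordinate at a time.
  let x : Stack m n := WithLp.toLp 2 fun i => EuclideanSpace.single c (u i)
  have hx : kronAct M x = 0 := by
    rw [kronAct_eq_zero_iff]
    intro c'
    by_cases h : c' = c
    · subst h
      have : (fun i => x i c') = fun i => u i := by
        ext i
        simp [x]
      rw [this]
      ext i
      exact congrArg (fun w : Vec m => w i) hu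
    · have : (fun i => x i c') = 0 := by
        ext i
        simp [x, h]
      rw [this, Matrix.mulVec_zero]
  have h := hz x hx
  rw [PiLp.inner_apply (𝕜 := ℝ) (f := fun _ : Fin m => Vec n)] at h
  rw [PiLp.inner_apply, ← h]
  refine Finset.sum_congr rfl fun i _ => ?_
  simp [x, stackCol, EuclideanSpace.inner_single_left, mul_comm]

theorem aeval_mulVec_eigenvectorBasis (hM : M.IsHermitian) (P : Polynomial ℝ) (i : Fin m) :
    (Polynomial.aeval M P).mulVec (hM.eigenvectorBasis i) =
      P.eval (hM.eigenvalues i) • (hM.eigenvectorBasis i).ofLp := by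
  induction P using Polynomial.induction_on' with
  | add p q hp hq => rw [map_add, Matrix.add_mulVec, hp, hq, Polynomial.eval_add, add_smul]
  | monomial k a =>
    rw [Polynomial.aeval_monomial, Polynomial.eval_monomial, ← Algebra.smul_def,
      Matrix.smul_mulVec, mul_smul]
    congr 1
    induction k with
    | zero => rw [pow_zero, Matrix.one_mulVec, pow_zero, one_smul]
    | succ k ih =>
      rw [pow_succ, ← Matrix.mulVec_mulVec, hM.mulVec_eigenvectorBasis, Matrix.mulVec_smul, ih,
        smul_smul, pow_succ, mul_comm]

theorem isHermitian_aeval (hM : M.IsHermitian) (P : Polynomial ℝ) :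
    (Polynomial.aeval M P).IsHermitian := by
  rw [Polynomial.aeval_eq_sum_range, Matrix.IsHermitian, Matrix.conjTranspose_sum]
  refine Finset.sum_congr rfl fun k _ => ?_
  rw [Matrix.conjTranspose_smul, star_trivial, (hM.pow k).eq]

theorem spectrum_aeval (hM : M.IsHermitian) (P : Polynomial ℝ) :
    spectrum ℝ (Polynomial.aeval M P) = P.eval '' spectrum ℝ M := by
  have hs : IsSelfAdjoint M := hM
  rw [← cfc_polynomial P M hs]
  exact cfc_map_spectrum _ M hs P.continuous.continuousOn

theorem toEuclideanLin_eq_zero_iff (hM : M.IsHermitian) (v : Vec m) :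
    Matrix.toEuclideanLin M v = 0 ↔
      ∀ i, hM.eigenvalues i * ⟪hM.eigenvectorBasis i, v⟫ = 0 := by
  constructor
  · intro h i
    rw [← inner_toEuclideanLin_eigenvectorBasis, h, inner_zero_right]
  · intro h
    rw [← norm_eq_zero, ← sq_eq_zero_iff, norm_sq_eq_sum_eigenvectorBasis hM]
    refine Finset.sum_eq_zero fun i _ => ?_
    rw [inner_toEuclideanLin_eigenvectorBasis, h, zero_pow two_ne_zero]

/-- Both M and P(M) are diagonal in the eigenbasis of M, and by hypothesis their diagonal entries
vanish at the same places. -/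
theorem aeval_mulVec_eq_zero_iff (hM : M.IsHermitian) {P : Polynomial ℝ}
    (hP : ∀ x ∈ spectrum ℝ M, P.eval x = 0 ↔ x = 0) (v : Fin m → ℝ) :
    (Polynomial.aeval M P).mulVec v = 0 ↔ M.mulVec v = 0 := by
  have key : ∀ i, ⟪hM.eigenvectorBasis i, Matrix.toEuclideanLin (Polynomial.aeval M P)
      (WithLp.toLp 2 v)⟫ = P.eval (hM.eigenvalues i) * ⟪hM.eigenvectorBasis i, WithLp.toLp 2 v⟫ := by
    intro i
    have h : Matrix.toEuclideanLin (Polynomial.aeval M P).transpose (hM.eigenvectorBasis i) =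
        P.eval (hM.eigenvalues i) • hM.eigenvectorBasis i := by
      rw [← Matrix.conjTranspose_eq_transpose_of_trivial, (isHermitian_aeval hM P).eq]
      exact PiLp.ext fun j => congrFun (aeval_mulVec_eigenvectorBasis hM P i) j
    rw [inner_toEuclideanLin, h, real_inner_smul_left]
  have e1 : ∀ A : Matrix (Fin m) (Fin m) ℝ,
      A.mulVec v = 0 ↔ Matrix.toEuclideanLin A (WithLp.toLp 2 v) = 0 := fun A =>
    ⟨fun h => PiLp.ext fun j => congrFun h j, fun h => funext fun j =>
      congrArg (fun w : Vec m => w j) h⟩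
  rw [e1, e1, toEuclideanLin_eq_zero_iff hM]
  have e2 : Matrix.toEuclideanLin (Polynomial.aeval M P) (WithLp.toLp 2 v) = 0 ↔
      ∀ i, P.eval (hM.eigenvalues i) * ⟪hM.eigenvectorBasis i, WithLp.toLp 2 v⟫ = 0 := by
    constructor
    · intro h i
      rw [← key, h, inner_zero_right]
    · intro h
      rw [← norm_eq_zero, ← sq_eq_zero_iff, norm_sq_eq_sum_eigenvectorBasis hM]
      refine Finset.sum_eq_zero fun i _ => ?_
      rw [key, h, zero_pow two_ne_zero]
  rw [e2]
  refine forall_congr' fun i => ?_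
  rw [mul_eq_zero, mul_eq_zero, hP _ (hM.eigenvalues_mem_spectrum_real i)]

theorem IsMixing.ne_zero {G : SimpleGraph (Fin m)} {W : Matrix (Fin m) (Fin m) ℝ}
    (hW : IsMixing G W) (hm : 2 ≤ m) : W ≠ 0 := by
  rintro rfl
  have h := (hW.kernel (fun i => if i.1 = 0 then 1 else 0)).1 (Matrix.zero_mulVec _)
    ⟨0, by omega⟩ ⟨1, by omega⟩
  simp at h

end Spectrum

/-! ### The Chebyshev polynomial of W -/

section Chebyshev

open Polynomial.Chebyshev

/-- By the recurrence, the increment T_{k+1} - T_k grows by 2(x-1)T_{k+1} ≥ 2(x-1) at each step,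
hence is at least (2k+1)(x-1). The odd numbers sum to k². -/
theorem one_add_sq_mul_le_eval_T (k : ℕ) {x : ℝ} (hx : 1 ≤ x) :
    1 + (k : ℝ) ^ 2 * (x - 1) ≤ (T ℝ k).eval x := by
  have key : ∀ k : ℕ, 1 + (k : ℝ) ^ 2 * (x - 1) ≤ (T ℝ k).eval x ∧
      (T ℝ k).eval x + (2 * k + 1) * (x - 1) ≤ (T ℝ (k + 1)).eval x := by
    intro k
    induction k with
    | zero => simp
    | succ k ih =>
      obtain ⟨h1, h2⟩ := ih
      have h3 : 1 + ((k + 1 : ℕ) : ℝ) ^ 2 * (x - 1) ≤ (T ℝ ((k + 1 : ℕ) : ℤ)).eval x := by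
        push_cast
        linarith
      refine ⟨h3, ?_⟩
      have h4 : 1 ≤ (T ℝ ((k + 1 : ℕ) : ℤ)).eval x := by
        have : 0 ≤ ((k + 1 : ℕ) : ℝ) ^ 2 * (x - 1) := mul_nonneg (by positivity) (by linarith)
        linarith
      have h5 : (T ℝ (((k + 1 : ℕ) : ℤ) + 1)).eval x =
          2 * x * (T ℝ ((k + 1 : ℕ) : ℤ)).eval x - (T ℝ k).eval x := by
        push_cast
        rw [show (k : ℤ) + 1 + 1 = k + 2 by ring, T_add_two]
        simp
      rw [h5]
      have h6 := mul_le_mul_of_nonneg_right h4 (show 0 ≤ x - 1 by linarith)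
      push_cast at h2 h6 ⊢
      linarith
  exact (key k).1

variable {m : ℕ} {W : Matrix (Fin m) (Fin m) ℝ}

theorem chebPoly_natDegree_le (hW : W.PosSemidef) (h0 : W ≠ 0) :
    ((chebPoly W).natDegree : ℝ) ≤ 3 * √(chi W) := by
  have hχ := one_le_chi hW h0
  have h1 : (chebPoly W).natDegree ≤ ⌈√(2 * chi W)⌉₊ := by
    unfold chebPoly
    refine (Polynomial.natDegree_sub_le _ _).trans (max_le (by simp) ?_)
    refine (Polynomial.natDegree_C_mul_le _ _).trans (Polynomial.natDegree_comp_le.trans ?_)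
    rw [natDegree_T, Int.natAbs_natCast]
    refine mul_le_of_le_one_right (Nat.zero_le _) ?_
    refine (Polynomial.natDegree_sub_le _ _).trans (max_le (by simp) ?_)
    exact (Polynomial.natDegree_C_mul_le _ _).trans Polynomial.natDegree_X_le
  have h2 : (⌈√(2 * chi W)⌉₊ : ℝ) ≤ √(2 * chi W) + 1 := (Nat.ceil_lt_add_one (by positivity)).le
  have h3 : √(2 * chi W) ≤ 2 * √(chi W) := by
    rw [Real.sqrt_le_left (by positivity), mul_pow, Real.sq_sqrt (by linarith)]
    linarith
  have h4 : 1 ≤ √(chi W) := Real.one_le_sqrt.2 hχ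
  have h5 : ((chebPoly W).natDegree : ℝ) ≤ ⌈√(2 * chi W)⌉₊ := by exact_mod_cast h1
  linarith

theorem eval_chebPoly (W : Matrix (Fin m) (Fin m) ℝ) (x : ℝ) :
    (chebPoly W).eval x = 1 -
      ((T ℝ (⌈√(2 * chi W)⌉₊ : ℤ)).eval
        ((lamMax W + lamMinPos W / 2) / (lamMax W - lamMinPos W / 2)))⁻¹ *
      (T ℝ (⌈√(2 * chi W)⌉₊ : ℤ)).eval
        ((lamMax W + lamMinPos W / 2) / (lamMax W - lamMinPos W / 2) -
          2 / (lamMax W - lamMinPos W / 2) * x) := by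
  simp [chebPoly, Polynomial.eval_comp]

/-- Here θ(0) - 1 = λ_min⁺/(λ_max - λ_min⁺/2) ≥ 1/χ(W), and K² ≥ 2χ(W), so the quadratic growth of
T_K gives 1 + 2. -/
theorem three_le_eval_T (hW : W.PosSemidef) (h0 : W ≠ 0) :
    3 ≤ (T ℝ (⌈√(2 * chi W)⌉₊ : ℤ)).eval
      ((lamMax W + lamMinPos W / 2) / (lamMax W - lamMinPos W / 2)) := by
  have hl := lamMinPos_pos hW h0
  have hb := lamMinPos_le_lamMax hW.isHermitian h0
  have hba : 0 < lamMax W - lamMinPos W / 2 := by linarith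
  set K := ⌈√(2 * chi W)⌉₊
  set x := (lamMax W + lamMinPos W / 2) / (lamMax W - lamMinPos W / 2) with hx
  have hx1 : x - 1 = lamMinPos W / (lamMax W - lamMinPos W / 2) := by
    rw [hx, div_sub_one hba.ne']
    congr 1
    ring
  have hx0 : 0 ≤ x - 1 := by rw [hx1]; positivity
  refine le_trans ?_ (one_add_sq_mul_le_eval_T K (by linarith))
  have hK : 2 * chi W ≤ (K : ℝ) ^ 2 := by
    rw [← Real.sqrt_le_left (by positivity)]
    exact Nat.le_ceil _
  have h1 : 2 ≤ 2 * chi W * (x - 1) := by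
    have : 2 * chi W * (x - 1) = 2 * lamMax W / (lamMax W - lamMinPos W / 2) := by
      rw [hx1, chi]
      field_simp
    rw [this, le_div_iff₀ hba]
    linarith
  have h2 := mul_le_mul_of_nonneg_right hK hx0
  linarith

theorem eval_chebPoly_zero (hW : W.PosSemidef) (h0 : W ≠ 0) : (chebPoly W).eval 0 = 0 := by
  have h := three_le_eval_T hW h0
  rw [eval_chebPoly, mul_zero, sub_zero, inv_mul_cancel₀ (by linarith), sub_self]

/-- θ maps the nonzero spectrum into [-1, 1], where |T_K| ≤ 1; division by T_K(θ(0)) ≥ 3 leaves a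
deviation of at most 1/3 from 1. -/
theorem eval_chebPoly_mem (hW : W.PosSemidef) (h0 : W ≠ 0) {x : ℝ} (hx : x ∈ spectrum ℝ W)
    (hx0 : x ≠ 0) : (chebPoly W).eval x ∈ Set.Icc (2 / 3) (4 / 3) := by
  have h := three_le_eval_T hW h0
  have hl := lamMinPos_pos hW h0
  have hb := lamMinPos_le_lamMax hW.isHermitian h0
  have hba : 0 < lamMax W - lamMinPos W / 2 := by linarith
  have h1 := lamMinPos_le hx hx0
  have h2 := le_lamMax hx
  have hT : |(T ℝ (⌈√(2 * chi W)⌉₊ : ℤ)).eval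
        ((lamMax W + lamMinPos W / 2) / (lamMax W - lamMinPos W / 2) -
          2 / (lamMax W - lamMinPos W / 2) * x)| ≤ 1 := by
    refine abs_eval_T_real_le_one _ ?_
    have : (lamMax W + lamMinPos W / 2) / (lamMax W - lamMinPos W / 2) -
          2 / (lamMax W - lamMinPos W / 2) * x =
        (lamMax W + lamMinPos W / 2 - 2 * x) / (lamMax W - lamMinPos W / 2) := by ring
    rw [this, abs_div, abs_of_pos hba, div_le_one hba, abs_le]
    constructor <;> linarith
  rw [eval_chebPoly]
  set τ := (T ℝ (⌈√(2 * chi W)⌉₊ : ℤ)).eval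
      ((lamMax W + lamMinPos W / 2) / (lamMax W - lamMinPos W / 2))
  set y := (T ℝ (⌈√(2 * chi W)⌉₊ : ℤ)).eval
        ((lamMax W + lamMinPos W / 2) / (lamMax W - lamMinPos W / 2) -
          2 / (lamMax W - lamMinPos W / 2) * x)
  have h3 : |τ⁻¹ * y| ≤ 1 / 3 := by
    rw [abs_mul, abs_inv, abs_of_pos (by linarith : 0 < τ)]
    calc τ⁻¹ * |y| ≤ 3⁻¹ * 1 := by gcongr
      _ = 1 / 3 := by norm_num
  obtain ⟨h4, h5⟩ := abs_le.1 h3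
  constructor <;> linarith

theorem eval_chebPoly_eq_zero_iff (hW : W.PosSemidef) (h0 : W ≠ 0) {x : ℝ}
    (hx : x ∈ spectrum ℝ W) : (chebPoly W).eval x = 0 ↔ x = 0 := by
  constructor
  · intro h
    by_contra hne
    have := (eval_chebPoly_mem hW h0 hx hne).1
    linarith
  · rintro rfl
    exact eval_chebPoly_zero hW h0

theorem aeval_chebPoly_mulVec_eq_zero_iff (hW : W.PosSemidef) (h0 : W ≠ 0) (v : Fin m → ℝ) :
    (Polynomial.aeval W (chebPoly W)).mulVec v = 0 ↔ W.mulVec v = 0 :=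
  aeval_mulVec_eq_zero_iff hW.isHermitian (fun _ hx => eval_chebPoly_eq_zero_iff hW h0 hx) v

theorem aeval_chebPoly_ne_zero (hW : W.PosSemidef) (h0 : W ≠ 0) :
    Polynomial.aeval W (chebPoly W) ≠ 0 := by
  intro h
  refine h0 (Matrix.ext_of_mulVec_single fun i => ?_)
  rw [(aeval_chebPoly_mulVec_eq_zero_iff hW h0 _).1 (by rw [h, Matrix.zero_mulVec]),
    Matrix.zero_mulVec]

theorem spectrum_aeval_chebPoly_subset (hW : W.PosSemidef) (h0 : W ≠ 0) :
    spectrum ℝ (Polynomial.aeval W (chebPoly W)) ⊆ {0} ∪ Set.Icc (2 / 3) (4 / 3) := by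
  rw [spectrum_aeval hW.isHermitian]
  rintro _ ⟨x, hx, rfl⟩
  by_cases hx0 : x = 0
  · exact Or.inl ((eval_chebPoly_eq_zero_iff hW h0 hx).2 hx0)
  · exact Or.inr (eval_chebPoly_mem hW h0 hx hx0)

theorem posSemidef_aeval_chebPoly (hW : W.PosSemidef) (h0 : W ≠ 0) :
    (Polynomial.aeval W (chebPoly W)).PosSemidef := by
  refine Matrix.posSemidef_iff_isHermitian_and_spectrum_nonneg.2
    ⟨isHermitian_aeval hW.isHermitian _, fun x hx => ?_⟩
  rcases spectrum_aeval_chebPoly_subset hW h0 hx with h | h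
  · exact (Set.mem_singleton_iff.1 h).ge
  · exact le_trans (by norm_num) h.1

theorem lamMinPos_aeval_chebPoly (hW : W.PosSemidef) (h0 : W ≠ 0) :
    2 / 3 ≤ lamMinPos (Polynomial.aeval W (chebPoly W)) := by
  have h := lamMinPos_mem (posSemidef_aeval_chebPoly hW h0).isHermitian
    (aeval_chebPoly_ne_zero hW h0)
  rcases spectrum_aeval_chebPoly_subset hW h0 h.1 with h' | h'
  · exact absurd h' h.2
  · exact h'.1

theorem lamMax_aeval_chebPoly (hW : W.PosSemidef) (h0 : W ≠ 0) :
    lamMax (Polynomial.aeval W (chebPoly W)) ≤ 4 / 3 := by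
  have h := lamMax_mem (posSemidef_aeval_chebPoly hW h0).isHermitian
    (aeval_chebPoly_ne_zero hW h0)
  rcases spectrum_aeval_chebPoly_subset hW h0 h with h' | h'
  · rw [Set.mem_singleton_iff.1 h']
    norm_num
  · exact h'.2

theorem chi_aeval_chebPoly_le (hW : W.PosSemidef) (h0 : W ≠ 0) :
    chi (Polynomial.aeval W (chebPoly W)) ≤ 2 := by
  have h1 := lamMinPos_aeval_chebPoly hW h0
  have h2 := lamMax_aeval_chebPoly hW h0
  rw [chi, div_le_iff₀ (by linarith)]
  linarith

end Chebyshev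

/-! ### Strong duality, accuracy and complexity of the two methods -/

section Complexity

variable {m d p r : ℕ}

theorem inner_kronCLM {M : Matrix (Fin m) (Fin m) ℝ} (hM : M.IsHermitian) (x y : Stack m r) :
    ⟪kronCLM r M x, y⟫ = ⟪x, kronCLM r M y⟫ := inner_kronAct hM x y

theorem kronAct_eq_zero_congr {M W : Matrix (Fin m) (Fin m) ℝ}
    (hk : ∀ v : Fin m → ℝ, M.mulVec v = 0 ↔ W.mulVec v = 0) (t : Stack m r) :
    kronAct M t = 0 ↔ kronAct W t = 0 := by
  rw [kronAct_eq_zero_iff, kronAct_eq_zero_iff]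
  exact forall_congr' fun c => hk _

/-- Strong duality between the constrained problem and its locally dual form. -/
theorem strong_duality {W M : Matrix (Fin m) (Fin m) ℝ} (hM : M.IsHermitian)
    (hk : ∀ v : Fin m → ℝ, M.mulVec v = 0 ↔ W.mulVec v = 0)
    {B : Matrix (Fin p) (Fin d) ℝ} {E : Matrix (Fin d) (Fin r) ℝ} (hE : IsKernelBasis B E)
    {c : ℝ} (hc : 0 < c) {f : Fin m → Vec d → ℝ}
    (hh : ∀ i, StronglyConvexWith c (reparam f E i)) :
    (∃ z, ∀ z', dualObj (reparam f E) M z ≤ dualObj (reparam f E) M z') ∧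
      (∀ z, (∀ z', dualObj (reparam f E) M z ≤ dualObj (reparam f E) M z') →
        IsLeast (sepSum f '' feasible B W) (-dualObj (reparam f E) M z)) := by
  have hH := stronglyConvexWith_sepSum hh
  obtain ⟨z, t, ht, hzt, hz⟩ := hH.exists_dual_minimizer hc (inner_kronCLM hM)
  refine ⟨⟨z, hz⟩, fun w hw => ⟨?_, ?_⟩⟩
  · have h : dualObj (reparam f E) M w = -sepSum (reparam f E) t :=
      le_antisymm ((hw z).trans hzt.le) (hzt.ge.trans (hz w))
    rw [h, neg_neg]
    exact ⟨blockAct E t, (mem_feasible_iff hE W _).2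
      ⟨t, (kronAct_eq_zero_congr hk t).1 ht, rfl⟩, rfl⟩
  · rintro _ ⟨y, hy, rfl⟩
    obtain ⟨u, hu, rfl⟩ := (mem_feasible_iff hE W y).1 hy
    have h := hH.neg_le_conjugate hc (inner_kronCLM hM) w ((kronAct_eq_zero_congr hk u).2 hu)
    rw [sepSum_blockAct]
    exact neg_le.1 h

/-- The range of `E` is ker B, so the B-component vanishes exactly, and I⊗E preserves the norm of
the consensus residual. -/
theorem norm_constraintMap {B : Matrix (Fin p) (Fin d) ℝ} {E : Matrix (Fin d) (Fin r) ℝ}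
    (hE : IsKernelBasis B E) (W : Matrix (Fin m) (Fin m) ℝ) {γ : ℝ} (hγ : 0 ≤ γ)
    (t : Stack m r) : ‖constraintMap B W γ (blockAct E t)‖ = γ * ‖kronAct W t‖ := by
  have h : blockAct B (blockAct E t) = 0 := (blockAct_eq_zero_iff hE _).2 ⟨t, rfl⟩
  rw [← sq_eq_sq₀ (norm_nonneg _) (by positivity), WithLp.prod_norm_sq_eq_of_L2]
  change ‖blockAct B (blockAct E t)‖ ^ 2 + ‖γ • kronAct W (blockAct E t)‖ ^ 2 = _
  rw [h, norm_zero, kronAct_blockAct, norm_smul, norm_blockAct hE.orthonormal,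
    Real.norm_of_nonneg hγ]
  ring

/-- The accuracy reached after `N` steps, for a matrix `M = P(W)` with the same kernel as `W`. -/
theorem locallyDual_accuracy {G : SimpleGraph (Fin m)} {W : Matrix (Fin m) (Fin m) ℝ}
    (hW : IsMixing G W) {P : Polynomial ℝ} {M : Matrix (Fin m) (Fin m) ℝ}
    (hPM : Polynomial.aeval W P = M) (hM : M.PosSemidef) (hM0 : M ≠ 0)
    (hk : ∀ v : Fin m → ℝ, M.mulVec v = 0 ↔ W.mulVec v = 0)
    {B : Matrix (Fin p) (Fin d) ℝ} {E : Matrix (Fin d) (Fin r) ℝ} (hE : IsKernelBasis B E)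
    {μt Lt : ℝ} (hμ : 0 < μt) (hμL : μt ≤ Lt) {f : Fin m → Vec d → ℝ}
    (hh : ∀ i, StronglyConvexWith μt (reparam f E i)) (hs : ∀ i, SmoothWith Lt (reparam f E i))
    {z₀ zs : Stack m r} {R : ℝ}
    (hzs : ∀ z, dualObj (reparam f E) M zs ≤ dualObj (reparam f E) M z) (hR : ‖zs‖ ≤ R)
    (hR' : ‖z₀ - zs‖ ≤ R) (N : ℕ) :
    ∃ t, (locallyDual G W P f E μt Lt z₀ N).val = blockAct E t ∧
      (∀ y ∈ feasible B W, sepSum f (blockAct E t) - sepSum f y ≤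
        4 * (√(Lt / μt) * chi M * (lamMax M ^ 2 / μt) * R ^ 2) *
          Real.exp (-(N / (2 * (√(Lt / μt) * chi M))))) ∧
      ‖kronAct M t‖ ≤ 2 * (lamMax M ^ 2 / μt * R) *
        Real.exp (-(N / (2 * (√(Lt / μt) * chi M)))) := by
  have hH := stronglyConvexWith_sepSum hh
  refine ⟨_, locallyDual_val hW hPM Lt hμ hh z₀ N, ?_⟩
  obtain ⟨h1, h2⟩ := fastGradientIter_dual hH hμ (smoothWith_sepSum hs) hμL
    (inner_kronCLM hM.isHermitian) (lamMinPos_pos hM hM0) (lamMinPos_le_lamMax hM.isHermitian hM0)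
    (norm_kronAct_le hM hM0) (fun _ hz => le_norm_kronAct hM hM0 hz) (s := √(Lt / μt) * chi M)
    rfl hzs hR hR' N rfl
  refine ⟨fun y hy => ?_, h2⟩
  obtain ⟨u, hu, rfl⟩ := (mem_feasible_iff hE W y).1 hy
  -- Weak duality replaces the optimal dual value by the objective at an arbitrary feasible point.
  have h3 := hH.neg_le_conjugate hμ (inner_kronCLM hM.isHermitian) zs
    ((kronAct_eq_zero_congr hk u).2 hu)
  refine le_trans ?_ h1
  rw [sepSum_blockAct, sepSum_blockAct]
  have h4 : -sepSum (reparam f E) u ≤ conjugate (sepSum (reparam f E)) (kronCLM r M zs) := h3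
  rw [sub_eq_add_neg]
  exact add_le_add_right h4 _

/-- Dropping the component of t in the common kernel changes neither residual; on the complement M
is bounded below and W above. -/
theorem norm_kronAct_le_of_ker_eq {W M : Matrix (Fin m) (Fin m) ℝ} (hW : W.PosSemidef)
    (hW0 : W ≠ 0) (hM : M.PosSemidef) (hM0 : M ≠ 0)
    (hk : ∀ v : Fin m → ℝ, M.mulVec v = 0 ↔ W.mulVec v = 0) (t : Stack m r) :
    lamMinPos M * ‖kronAct W t‖ ≤ lamMax W * ‖kronAct M t‖ := by
  set u := coimageProj (kronCLM r M) t with hu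
  have hl := (lamMinPos_pos hW hW0).le.trans (lamMinPos_le_lamMax hW.isHermitian hW0)
  have h1 : kronCLM r M u = kronCLM r M t := apply_coimageProj (kronCLM r M) t
  have h2 : kronCLM r W (t - u) = 0 := by
    refine (kronAct_eq_zero_congr hk (t - u)).1 ?_
    change kronCLM r M (t - u) = 0
    rw [map_sub, h1, sub_self]
  rw [map_sub, sub_eq_zero] at h2
  have h3 := le_norm_kronAct hM hM0 (coimageProj_mem (kronCLM r M) t)
  rw [← hu] at h3
  rw [show kronAct W t = kronAct W u from h2, show kronAct M t = kronAct M u from h1.symm]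
  calc lamMinPos M * ‖kronAct W u‖ ≤ lamMinPos M * (lamMax W * ‖u‖) :=
        mul_le_mul_of_nonneg_left (norm_kronAct_le hW hW0 u) (lamMinPos_pos hM hM0).le
    _ = lamMax W * (lamMinPos M * ‖u‖) := by ring
    _ ≤ lamMax W * ‖kronAct M u‖ := mul_le_mul_of_nonneg_left h3 hl

/-- With u = (2+Θ)/ε ≥ 2, the exponential is at most u^{-(j+1)}: j of the factors absorb the
numerical constant 2^j, and the last one absorbs Θ ≤ εu. -/
theorem mul_exp_le_of_log_le {s Θ ε x : ℝ} (j : ℕ) (hs : 0 < s) (hΘ : 0 ≤ Θ) (hε : 0 < ε)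
    (hε1 : ε ≤ 1) (hx : 2 * (j + 1) * (s * Real.log ((2 + Θ) / ε)) ≤ x) :
    2 ^ j * (Θ * Real.exp (-(x / (2 * s)))) ≤ ε := by
  set u := (2 + Θ) / ε with hu
  have hu2 : 2 ≤ u := by
    rw [hu, le_div_iff₀ hε]
    linarith
  have hu0 : 0 < u := by linarith
  have h1 : Real.exp (-(x / (2 * s))) ≤ (u ^ (j + 1))⁻¹ := by
    have h2 : (j + 1 : ℕ) * Real.log u ≤ x / (2 * s) := by
      rw [le_div_iff₀ (by positivity)]
      push_cast
      linarith
    rw [Real.exp_neg]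
    refine inv_anti₀ (by positivity) ?_
    rw [← Real.exp_log (pow_pos hu0 (j + 1)), Real.log_pow]
    exact Real.exp_le_exp.2 h2
  have h3 : Θ ≤ ε * u := by
    rw [hu, mul_div_cancel₀ _ hε.ne']
    linarith
  calc 2 ^ j * (Θ * Real.exp (-(x / (2 * s)))) ≤ u ^ j * (ε * u * (u ^ (j + 1))⁻¹) := by gcongr
    _ = ε := by
      rw [pow_succ]
      field_simp

/-- Keeps the logarithm away from 0, so that rounding up and the final oracle call can be absorbed
into the constant. -/
theorem half_le_log {Θ ε : ℝ} (hΘ : 0 ≤ Θ) (hε : 0 < ε) (hε1 : ε ≤ 1) :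
    1 / 2 ≤ Real.log ((2 + Θ) / ε) := by
  have h1 : 2 ≤ (2 + Θ) / ε := by
    rw [le_div_iff₀ hε]
    linarith
  have h2 := Real.log_le_log (by norm_num) h1
  have := Real.log_two_gt_d9
  linarith

theorem plain_complexity {G : SimpleGraph (Fin m)} {W : Matrix (Fin m) (Fin m) ℝ} (hm : 2 ≤ m)
    (hW : IsMixing G W)
    {B : Matrix (Fin p) (Fin d) ℝ} {E : Matrix (Fin d) (Fin r) ℝ} (hE : IsKernelBasis B E)
    {μt Lt : ℝ} (hμ : 0 < μt) (hμL : μt ≤ Lt) {f : Fin m → Vec d → ℝ}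
    (hh : ∀ i, StronglyConvexWith μt (reparam f E i)) (hs : ∀ i, SmoothWith Lt (reparam f E i))
    {z₀ zs : Stack m r} {R γ ε : ℝ}
    (hzs : ∀ z, dualObj (reparam f E) W zs ≤ dualObj (reparam f E) W z) (hR : ‖zs‖ ≤ R)
    (hR' : ‖z₀ - zs‖ ≤ R) (hγ : 0 < γ) (hε : 0 < ε) (hε1 : ε ≤ 1) :
    ∃ N : ℕ,
      (∀ N' ≥ N, IsAccurate f B W γ ε (locallyDual G W Polynomial.X f E μt Lt z₀ N').val) ∧
      ((locallyDual G W Polynomial.X f E μt Lt z₀ N).oracleCalls : ℝ) ≤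
        30 * (√(Lt / μt) * chi W * Real.log
          ((2 + √(Lt / μt) * chi W * (lamMax W ^ 2 / μt) * R * (R + γ)) / ε)) ∧
      ((locallyDual G W Polynomial.X f E μt Lt z₀ N).communications : ℝ) ≤
        30 * (√(Lt / μt) * chi W * Real.log
          ((2 + √(Lt / μt) * chi W * (lamMax W ^ 2 / μt) * R * (R + γ)) / ε)) := by
  have hW0 := hW.ne_zero hm
  have hχ := one_le_chi hW.posSemidef hW0
  have hsq : 1 ≤ √(Lt / μt) := Real.one_le_sqrt.2 ((one_le_div hμ).2 hμL)
  have hacc := fun N => locallyDual_accuracy hW (Polynomial.aeval_X W) hW.posSemidef hW0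
    (fun _ => Iff.rfl) hE hμ hμL hh hs hzs hR hR' N
  set s := √(Lt / μt) * chi W with hsdef
  have hs1 : 1 ≤ s := one_le_mul_of_one_le_of_one_le hsq hχ
  have hR0 : 0 ≤ R := (norm_nonneg _).trans hR
  set Λ := lamMax W ^ 2 / μt with hΛ
  have hΛ0 : 0 ≤ Λ := by positivity
  set Θ := s * Λ * R * (R + γ) with hΘ
  have hΘ0 : 0 ≤ Θ := by positivity
  set ℓ := Real.log ((2 + Θ) / ε) with hℓ
  have hℓ1 : 1 / 2 ≤ ℓ := half_le_log hΘ0 hε hε1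
  have hsℓ : 1 * (1 / 2) ≤ s * ℓ := mul_le_mul hs1 hℓ1 (by norm_num) (by linarith)
  have hceil : (⌈6 * (s * ℓ)⌉₊ : ℝ) ≤ 6 * (s * ℓ) + 1 := (Nat.ceil_lt_add_one (by linarith)).le
  -- The factor 4 = 2² in the accuracy bound requires 6 = 2(2+1). Since sℓ ≥ 1/2, both N + 1 and 2N
  -- + 1 stay below 30sℓ.
  refine ⟨⌈6 * (s * ℓ)⌉₊, fun N' hN' => ?_, ?_, ?_⟩
  · obtain ⟨t, ht, h1, h2⟩ := hacc N'
    have hN : 6 * (s * ℓ) ≤ (N' : ℝ) := (Nat.le_ceil _).trans (by exact_mod_cast hN')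
    have hexp := mul_exp_le_of_log_le 2 (by linarith : 0 < s) hΘ0 hε hε1 (x := N') (by
      rw [← hℓ]
      push_cast
      linarith)
    set e := Real.exp (-(N' / (2 * s)))
    have he0 : 0 < e := Real.exp_pos _
    rw [ht]
    refine ⟨fun y hy => (h1 y hy).trans ?_, ?_⟩
    · have h3 : 0 ≤ s * Λ * R * γ * e := by positivity
      refine le_trans ?_ hexp
      rw [hΘ]
      linarith
    · rw [norm_constraintMap hE W hγ.le]
      have h3 : 0 ≤ s * Λ * R ^ 2 * e := by positivity
      have h4 : γ * ‖kronAct W t‖ ≤ γ * (2 * (Λ * R) * e) := mul_le_mul_of_nonneg_left h2 hγ.le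
      have h5 : 1 * (γ * Λ * R * e) ≤ s * (γ * Λ * R * e) :=
        mul_le_mul_of_nonneg_right hs1 (by positivity)
      have h6 : 0 ≤ γ * Λ * R * e := by positivity
      refine le_trans ?_ hexp
      rw [hΘ]
      linarith
  · rw [locallyDual_oracleCalls]
    push_cast
    linarith
  · rw [locallyDual_communications, Polynomial.natDegree_X]
    push_cast
    linarith

theorem chebyshev_complexity {G : SimpleGraph (Fin m)} {W : Matrix (Fin m) (Fin m) ℝ}
    (hm : 2 ≤ m) (hW : IsMixing G W)
    {B : Matrix (Fin p) (Fin d) ℝ} {E : Matrix (Fin d) (Fin r) ℝ} (hE : IsKernelBasis B E)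
    {μt Lt : ℝ} (hμ : 0 < μt) (hμL : μt ≤ Lt) {f : Fin m → Vec d → ℝ}
    (hh : ∀ i, StronglyConvexWith μt (reparam f E i)) (hs : ∀ i, SmoothWith Lt (reparam f E i))
    {z₀ zs : Stack m r} {R γ ε : ℝ}
    (hzs : ∀ z, dualObj (reparam f E) (Polynomial.aeval W (chebPoly W)) zs ≤
      dualObj (reparam f E) (Polynomial.aeval W (chebPoly W)) z) (hR : ‖zs‖ ≤ R)
    (hR' : ‖z₀ - zs‖ ≤ R) (hγ : 0 < γ) (hε : 0 < ε) (hε1 : ε ≤ 1) :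
    ∃ N : ℕ,
      (∀ N' ≥ N, IsAccurate f B W γ ε (locallyDual G W (chebPoly W) f E μt Lt z₀ N').val) ∧
      ((locallyDual G W (chebPoly W) f E μt Lt z₀ N).oracleCalls : ℝ) ≤
        30 * (√(Lt / μt) * Real.log
          ((2 + √(Lt / μt) * (1 / μt) * R * (R + γ * lamMax W)) / ε)) ∧
      ((locallyDual G W (chebPoly W) f E μt Lt z₀ N).communications : ℝ) ≤
        30 * ((locallyDual G W (chebPoly W) f E μt Lt z₀ N).oracleCalls * √(chi W)) := by
  have hW0 := hW.ne_zero hm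
  have hWp := hW.posSemidef
  have hM := posSemidef_aeval_chebPoly hWp hW0
  have hM0 := aeval_chebPoly_ne_zero hWp hW0
  have hk := aeval_chebPoly_mulVec_eq_zero_iff hWp hW0
  have hsq : 1 ≤ √(Lt / μt) := Real.one_le_sqrt.2 ((one_le_div hμ).2 hμL)
  have hacc := fun N => locallyDual_accuracy hW rfl hM hM0 hk hE hμ hμL hh hs hzs hR hR' N
  have hker := norm_kronAct_le_of_ker_eq (r := r) hWp hW0 hM hM0 hk
  have hl := lamMinPos_aeval_chebPoly hWp hW0
  have hΛ := lamMax_aeval_chebPoly hWp hW0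
  have hlΛ := lamMinPos_le_lamMax hM.isHermitian hM0
  have hχ := chi_aeval_chebPoly_le hWp hW0
  have hχ1 := one_le_chi hM hM0
  have hdeg := chebPoly_natDegree_le hWp hW0
  have hw : 0 ≤ lamMax W := (lamMinPos_pos hWp hW0).le.trans
    (lamMinPos_le_lamMax hWp.isHermitian hW0)
  set M := Polynomial.aeval W (chebPoly W) with hMdef
  set σ := √(Lt / μt) with hσ
  have hR0 : 0 ≤ R := (norm_nonneg _).trans hR
  set Θ := σ * (1 / μt) * R * (R + γ * lamMax W) with hΘ
  have hΘ0 : 0 ≤ Θ := by positivity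
  set ℓ := Real.log ((2 + Θ) / ε) with hℓ
  have hℓ1 : 1 / 2 ≤ ℓ := half_le_log hΘ0 hε hε1
  have hσℓ : 1 * (1 / 2) ≤ σ * ℓ := mul_le_mul hsq hℓ1 (by norm_num) (by linarith)
  have hs0 : 0 < σ * chi M := by positivity
  have hsℓ : σ * chi M * ℓ ≤ 2 * (σ * ℓ) := by
    have := mul_le_mul_of_nonneg_left hχ (show 0 ≤ σ * ℓ by linarith)
    linarith
  have hceil : (⌈10 * (σ * chi M * ℓ)⌉₊ : ℝ) ≤ 10 * (σ * chi M * ℓ) + 1 :=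
    (Nat.ceil_lt_add_one (by positivity)).le
  have hΛ2 : lamMax M ^ 2 / μt ≤ 2 * (1 / μt) := by
    rw [mul_one_div]
    gcongr
    have h1 : lamMax M ^ 2 ≤ (4 / 3) ^ 2 := pow_le_pow_left₀ (by linarith) hΛ 2
    linarith
  -- With χ(M) ≤ 2 and λ_max(M)² ≤ 16/9 ≤ 2, the objective bound has the factor 4·2·2 = 2⁴, which
  -- requires 10 = 2(4+1). The residual bound, after the loss of 3/2 in passing from M to W, has the
  -- factor 6.
  refine ⟨⌈10 * (σ * chi M * ℓ)⌉₊, fun N' hN' => ?_, ?_, ?_⟩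
  · obtain ⟨t, ht, h1, h2⟩ := hacc N'
    have hN : 10 * (σ * chi M * ℓ) ≤ (N' : ℝ) := (Nat.le_ceil _).trans (by exact_mod_cast hN')
    have hexp := mul_exp_le_of_log_le 4 hs0 hΘ0 hε hε1 (x := N') (by
      rw [← hℓ]
      push_cast
      linarith)
    set e := Real.exp (-(N' / (2 * (σ * chi M))))
    have he0 : 0 < e := Real.exp_pos _
    rw [ht]
    refine ⟨fun y hy => (h1 y hy).trans ?_, ?_⟩
    · have h3 : 0 ≤ σ * (1 / μt) * R * (γ * lamMax W) * e := by positivity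
      refine le_trans ?_ hexp
      have h4 : σ * chi M * (lamMax M ^ 2 / μt) * R ^ 2 ≤ σ * 2 * (2 * (1 / μt)) * R ^ 2 := by
        gcongr
      have h5 := mul_le_mul_of_nonneg_right h4 he0.le
      rw [hΘ]
      linarith
    · rw [norm_constraintMap hE W hγ.le]
      have h3 : 0 ≤ σ * (1 / μt) * R ^ 2 * e := by positivity
      have h4 : ‖kronAct M t‖ ≤ 2 * (2 * (1 / μt) * R) * e := h2.trans (by gcongr)
      have h5 : 2 / 3 * ‖kronAct W t‖ ≤ lamMax W * (2 * (2 * (1 / μt) * R) * e) :=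
        (mul_le_mul_of_nonneg_right hl (norm_nonneg _)).trans
          ((hker t).trans (mul_le_mul_of_nonneg_left h4 hw))
      have h6 := mul_le_mul_of_nonneg_left h5 hγ.le
      have h7 : 0 ≤ γ * lamMax W * (1 / μt) * R * e := by positivity
      have h8 := mul_le_mul_of_nonneg_right hsq h7
      refine le_trans ?_ hexp
      rw [hΘ]
      linarith
  · rw [locallyDual_oracleCalls]
    push_cast
    linarith
  · rw [locallyDual_communications, locallyDual_oracleCalls]
    push_cast
    set N : ℝ := (⌈10 * (σ * chi M * ℓ)⌉₊ : ℝ)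
    have hN0 : 0 ≤ N := Nat.cast_nonneg _
    calc (2 * N + 1) * ((chebPoly W).natDegree : ℝ) ≤ (2 * (N + 1)) * (3 * √(chi W)) := by
          gcongr
          linarith
      _ ≤ 30 * ((N + 1) * √(chi W)) := by
          have : 0 ≤ (N + 1) * √(chi W) := by positivity
          linarith

end Complexity

end LocallyDual

theorem mainTheorem4 :
    ∃ C : ℝ, 0 < C ∧
    ∀ (m d p r : ℕ) (_ : 2 ≤ m)
      (G : SimpleGraph (Fin m)) (_ : G.Connected)
      (W : Matrix (Fin m) (Fin m) ℝ) (_ : IsMixing G W)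
      (B : Matrix (Fin p) (Fin d) ℝ) (_ : ∃ x : Fin d → ℝ, x ≠ 0 ∧ B.mulVec x = 0)
      (E : Matrix (Fin d) (Fin r) ℝ) (_ : IsKernelBasis B E)
      (μ L : ℝ) (_ : 0 < μ)
      (f : Fin m → Vec d → ℝ)
      (_ : ∀ i, StronglyConvexWith μ (f i)) (_ : ∀ i, SmoothWith L (f i)),
    -- the dimension of the new variable
    r + B.rank = d ∧
    -- the best constants of the `hᵢ` exist and are no worse than those of the `fᵢ`
    (∃ μs Ls : ℝ, IsGreatest {c | ∀ i, StronglyConvexWith c (reparam f E i)} μs ∧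
      IsLeast {c | ∀ i, SmoothWith c (reparam f E i)} Ls ∧ μ ≤ μs ∧ Ls ≤ L) ∧
    -- the conjugate under the affine constraints is `H*`, in the coordinates given by `E`
    (∀ v : Stack m d, IsLUB ((fun x => inner ℝ v x - sepSum f x) '' {x | blockAct B x = 0})
      (conjugate (sepSum (reparam f E)) (blockAct E.transpose v))) ∧
    -- the gradient of `H*` is the unique maximizer in the definition of `H*`
    (∀ z t : Stack m r,
      IsMaxOn (fun t' => inner ℝ z t' - sepSum (reparam f E) t') Set.univ t ↔
        t = gradient (conjugate (sepSum (reparam f E))) z) ∧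
    -- strong duality, for the plain and for the accelerated form of the consensus constraint
    (∀ P : Polynomial ℝ, P = Polynomial.X ∨ P = chebPoly W →
      (∃ z, ∀ z', dualObj (reparam f E) (Polynomial.aeval W P) z ≤
        dualObj (reparam f E) (Polynomial.aeval W P) z') ∧
      (∀ z, (∀ z', dualObj (reparam f E) (Polynomial.aeval W P) z ≤
          dualObj (reparam f E) (Polynomial.aeval W P) z') →
        IsLeast (sepSum f '' feasible B W)
          (-dualObj (reparam f E) (Polynomial.aeval W P) z))) ∧
    -- the method uses gradients of the dual objective, at a cost of `deg P` rounds for each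
    -- multiplication by `P(W)`
    (∀ (P : Polynomial ℝ) (z : Stack m r),
      (polyGossip G W P z).val = kronAct (Polynomial.aeval W P) z ∧
      (polyGossip G W P z).communications = P.natDegree ∧
      (dualGrad G W P (reparam f E) z).val =
        gradient (dualObj (reparam f E) (Polynomial.aeval W P)) z) ∧
    -- the Chebyshev polynomial of `W`
    (((chebPoly W).natDegree : ℝ) ≤ C * √(chi W) ∧
      (Polynomial.aeval W (chebPoly W)).PosSemidef ∧
      (∀ v : Fin m → ℝ, (Polynomial.aeval W (chebPoly W)).mulVec v = 0 ↔ W.mulVec v = 0) ∧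
      chi (Polynomial.aeval W (chebPoly W)) ≤ C) ∧
    ∀ (μt Lt : ℝ), 0 < μt → (∀ i, StronglyConvexWith μt (reparam f E i)) →
      (∀ i, SmoothWith Lt (reparam f E i)) →
      -- smoothness and strong convexity of `H*`
      SmoothWith (1 / μt) (conjugate (sepSum (reparam f E))) ∧
      StronglyConvexWith (1 / Lt) (conjugate (sepSum (reparam f E))) ∧
      -- complexity of the plain method
      (∀ (z₀ zs : Stack m r) (R γ ε : ℝ),
        (∀ z, dualObj (reparam f E) W zs ≤ dualObj (reparam f E) W z) →
        ‖zs‖ ≤ R → ‖z₀ - zs‖ ≤ R → 0 < γ → 0 < ε → ε ≤ 1 →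
        ∃ N : ℕ,
          (∀ N' ≥ N, IsAccurate f B W γ ε
            (locallyDual G W Polynomial.X f E μt Lt z₀ N').val) ∧
          ((locallyDual G W Polynomial.X f E μt Lt z₀ N).oracleCalls : ℝ) ≤
            C * (√(Lt / μt) * chi W * Real.log
              ((2 + √(Lt / μt) * chi W * (lamMax W ^ 2 / μt) * R * (R + γ)) / ε)) ∧
          ((locallyDual G W Polynomial.X f E μt Lt z₀ N).communications : ℝ) ≤
            C * (√(Lt / μt) * chi W * Real.log
              ((2 + √(Lt / μt) * chi W * (lamMax W ^ 2 / μt) * R * (R + γ)) / ε))) ∧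
      -- complexity of the Chebyshev accelerated method
      (∀ (z₀ zs : Stack m r) (R γ ε : ℝ),
        (∀ z, dualObj (reparam f E) (Polynomial.aeval W (chebPoly W)) zs ≤
          dualObj (reparam f E) (Polynomial.aeval W (chebPoly W)) z) →
        ‖zs‖ ≤ R → ‖z₀ - zs‖ ≤ R → 0 < γ → 0 < ε → ε ≤ 1 →
        ∃ N : ℕ,
          (∀ N' ≥ N, IsAccurate f B W γ ε
            (locallyDual G W (chebPoly W) f E μt Lt z₀ N').val) ∧
          ((locallyDual G W (chebPoly W) f E μt Lt z₀ N).oracleCalls : ℝ) ≤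
            C * (√(Lt / μt) * Real.log
              ((2 + √(Lt / μt) * (1 / μt) * R * (R + γ * lamMax W)) / ε)) ∧
          ((locallyDual G W (chebPoly W) f E μt Lt z₀ N).communications : ℝ) ≤
            C * ((locallyDual G W (chebPoly W) f E μt Lt z₀ N).oracleCalls * √(chi W))) := by
  refine ⟨30, by norm_num, ?_⟩
  intro m d p r hm G _ W hW B hB E hE μ L hμ f hf hfs
  have hWp := hW.posSemidef
  have hW0 := hW.ne_zero hm
  have hh : ∀ i, StronglyConvexWith μ (reparam f E i) := fun i =>
    stronglyConvexWith_reparam (hf i) hE.orthonormal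
  have hhs : ∀ i, SmoothWith L (reparam f E i) := fun i =>
    smoothWith_reparam (hfs i) hE.orthonormal
  have hH := stronglyConvexWith_sepSum hh
  have : NeZero m := ⟨by omega⟩
  -- A nonzero vector of ker B has nonzero coordinates in `E`. Without one, strong convexity would
  -- hold with every constant and there would be no largest.
  have : Nontrivial (Vec r) := by
    obtain ⟨x, hx, hBx⟩ := hB
    obtain ⟨t, rfl⟩ := (hE.range_eq x).1 hBx
    refine ⟨WithLp.toLp 2 t, 0, fun h => hx ?_⟩
    have ht : t = 0 := congrArg WithLp.ofLp h
    rw [ht, Matrix.mulVec_zero]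
  refine ⟨rank_add_of_isKernelBasis hE, ?_, fun v => ?_, fun z t => ?_, ?_, fun P z => ?_, ?_, ?_⟩
  · obtain ⟨μs, h1, h2⟩ := exists_isGreatest_stronglyConvexWith hh hhs
    obtain ⟨Ls, h3, h4⟩ := exists_isLeast_smoothWith hh hhs
    exact ⟨μs, Ls, h1, h3, h2, h4⟩
  · have himg : (fun x => inner ℝ v x - sepSum f x) '' {x | blockAct B x = 0} =
        Set.range fun t => inner ℝ (blockAct E.transpose v) t - sepSum (reparam f E) t := by
      ext c
      constructor
      · rintro ⟨x, hx, rfl⟩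
        obtain ⟨t, rfl⟩ := (blockAct_eq_zero_iff hE x).1 hx
        exact ⟨t, by simp only [inner_blockAct, sepSum_blockAct]⟩
      · rintro ⟨t, rfl⟩
        exact ⟨blockAct E t, (blockAct_eq_zero_iff hE _).2 ⟨t, rfl⟩, by
          simp only [inner_blockAct, sepSum_blockAct]⟩
    rw [himg]
    exact hH.isLUB_conjugate hμ _
  · rw [hH.isMaxOn_iff hμ]
    constructor
    · rintro rfl
      exact (hH.gradient_conjugate hμ t).symm
    · rintro rfl
      exact hH.gradient_gradient_conjugate hμ z
  · rintro P (rfl | rfl)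
    · rw [Polynomial.aeval_X]
      exact strong_duality hWp.isHermitian (fun _ => Iff.rfl) hE hμ hh
    · exact strong_duality (isHermitian_aeval hWp.isHermitian _)
        (aeval_chebPoly_mulVec_eq_zero_iff hWp hW0) hE hμ hh
  · refine ⟨polyGossip_val hW P z, polyGossip_communications G W P z, ?_⟩
    rw [dualGrad_val hW P hh hμ]
    exact (HasGradientAt.comp_symmetric (inner_kronCLM (isHermitian_aeval hWp.isHermitian P))
      (hH.differentiable_conjugate hμ _).hasGradientAt).gradient.symm
  · refine ⟨?_, posSemidef_aeval_chebPoly hWp hW0, aeval_chebPoly_mulVec_eq_zero_iff hWp hW0,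
      (chi_aeval_chebPoly_le hWp hW0).trans (by norm_num)⟩
    exact (chebPoly_natDegree_le hWp hW0).trans
      (mul_le_mul_of_nonneg_right (by norm_num) (Real.sqrt_nonneg _))
  · intro μt Lt hμt hht hhst
    have hμL : μt ≤ Lt := (hht 0).le_of_smoothWith (hhst 0)
    have hHt := stronglyConvexWith_sepSum hht
    refine ⟨hHt.smoothWith_conjugate hμt,
      (smoothWith_sepSum hhst).stronglyConvexWith_conjugate (hμt.trans_le hμL) hHt hμt, ?_, ?_⟩
    · intro z₀ zs R γ ε hzs hR hR' hγ hε hε1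
      exact plain_complexity hm hW hE hμt hμL hht hhst hzs hR hR' hγ hε hε1
    · intro z₀ zs R γ ε hzs hR hR' hγ hε hε1
      exact chebyshev_complexity hm hW hE hμt hμL hht hhst hzs hR hR' hγ hε hε1
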